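/- The localization game with $k \ge 1$ cops on a finite connected graph $G$ is played as follows. An invisible robber first chooses a starting vertex. In each round the cops choose any $k$ vertices $c_1,\dots,c_k$ (not necessarily distinct, and with no restriction coming from their earlier choices) and learn the distance vector $(d(c_1,r),\dots,d(c_k,r))$, where $r$ is the robber's current vertex; then the robber stays where he is or moves to a neighbouring vertex. The cops' choices may depend on all distance vectors obtained so far, and the robber may know the cops' strategy in advance. The cops locate the robber after $s$ rounds if, after the $s$-th distance vector is obtained and before the robber's next move, only one position of the robber is consistent with the distance vectors obtained so far (for $s=0$: if $G$ has only one vertex). The localization number $\zeta(G)$ is the least $k\ge 1$ for which $k$ cops have a strategy that always locates the robber after finitely many rounds, and the localization capture time $\operatorname{lcapt}(G)$ is the least $t$ such that $\zeta(G)$ cops have a strategy that always locates the robber within $t$ rounds. If $T$ is a (finite) tree on $n$ vertices, then $$\operatorname{lcapt}(T) \leq \begin{cases} n-1, & \text{if } \zeta(T)=1,\\ \left\lfloor \frac n2\right\rfloor-3, & \text{if } \zeta(T)=2. \end{cases}$$ -/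

import Mathlib

namespace LocalizationGame

variable {V : Type*} {k : ℕ}

/-- A play of the (invisible) robber: `r i` is the vertex occupied by the robber when the cops make
their probe number `i + 1`. Between two probes the robber stays or moves along an edge; `r 0` is
the starting vertex, selected by the robber. -/
def IsRobberPlay (G : SimpleGraph V) (r : ℕ → V) : Prop :=
  ∀ i, r (i + 1) = r i ∨ G.Adj (r i) (r (i + 1))

/-- The distance vector obtained when the `k` cops probe the vertices `p` and the robber is
at `v`. -/
noncomputable def distVector (G : SimpleGraph V) (p : Fin k → V) (v : V) : Fin k → ℕ :=
  fun i => G.dist (p i) v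

/-- A strategy of `k` cops: given the list of all distance vectors obtained so far (oldest first),
it says which vertices the cops probe next. There is no restriction on the cops' movement. -/
abbrev CopStrategy (V : Type*) (k : ℕ) : Type _ := List (Fin k → ℕ) → (Fin k → V)

/-- The list of the first `s` distance vectors (oldest first) that the cops obtain when they
follow the strategy `σ` against the robber play `r`. -/
noncomputable def answers (G : SimpleGraph V) (σ : CopStrategy V k) (r : ℕ → V) :
    ℕ → List (Fin k → ℕ)
  | 0 => []
  | s + 1 => answers G σ r s ++ [distVector G (σ (answers G σ r s)) (r s)]

/-- After `s` probes, and before the robber's next move, the cops (following `σ`) have determined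
the position of the robber (who follows `r`): every robber play that leads to the same answers
has the robber at the same vertex. At that moment the robber is at `r (s - 1)` if `1 ≤ s`; for
`s = 0` (nothing probed yet) he is at his starting vertex `r 0`, which is also `r (s - 1)`
with truncated subtraction. -/
def Located (G : SimpleGraph V) (σ : CopStrategy V k) (r : ℕ → V) (s : ℕ) : Prop :=
  ∀ r', IsRobberPlay G r' → answers G σ r' s = answers G σ r s → r' (s - 1) = r (s - 1)

/-- `k` cops can guarantee to locate the robber on `G` within `t` rounds (probes), whatever the
robber, who may know the whole strategy of the cops, does. -/
def CopsWinWithin (G : SimpleGraph V) (k t : ℕ) : Prop :=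
  ∃ σ : CopStrategy V k, ∀ r, IsRobberPlay G r → ∃ s ≤ t, Located G σ r s

/-- `k` cops win the localization game on `G`: they can guarantee to locate the robber after
finitely many rounds. (On a finite graph every probe has only finitely many possible answers, so a
strategy that wins each play after finitely many rounds wins within a common number of rounds.) -/
def CopsWin (G : SimpleGraph V) (k : ℕ) : Prop :=
  ∃ t, CopsWinWithin G k t

/-- The localization number `ζ(G)`: the least (positive) number of cops that win on `G`. -/
noncomputable def locNumber (G : SimpleGraph V) : ℕ :=
  sInf {k | 1 ≤ k ∧ CopsWin G k}

/-- The `k`-localization capture time: the least number of rounds within which `k` cops can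
guarantee to locate the robber. It is meaningful when `k` cops win on `G`. -/
noncomputable def captK (G : SimpleGraph V) (k : ℕ) : ℕ :=
  sInf {t | CopsWinWithin G k t}

/-- The localization capture time: the `k`-localization capture time for `k = ζ(G)`. -/
noncomputable def locCaptureTime (G : SimpleGraph V) : ℕ :=
  captK G (locNumber G)

end LocalizationGame

/-!
Call a vertex big if it has at least three neighbours, and a hub if three of its neighbours are
big. The two cases of the theorem are separated by the existence of a hub (`IsHub`), and everything
is done with the sets of possible positions of the robber (`Wins`, `copsWinWithin_iff_wins`).

* If there is a hub, one cop does not win (`IsHub.not_wins_one`): the robber can always keep two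
  big neighbours of the hub, or the hub and another vertex, among his possible positions.
* If there is a hub, two cops win within `⌊n / 2⌋ - 3` rounds (`IsHub.wins_two`). A robber at known
  distance from `x`, in a union of branches at `x`, needs at most half as many rounds as this union
  has vertices: the cops probe two neighbours of `x` there, and either discard both branches or
  learn that the robber is in one of them, at known distance from its root. Near the hub a few
  vertices are saved.
* If there is no hub, one cop wins within `n - 1` rounds (`wins_one_of_no_hub`), so that
  `ζ(T) = 1` if and only if there is no hub. The branch of a neighbour that is not big can be
  discarded by one probe (`exists_probe_of_not_isBig`). In a branch that is entered from `p` through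
  its root `x`, this is enough when at most one neighbour of `x` there is big
  (`RootedBound.wins_of_closedUpTo`). Otherwise exactly two are, since `x` is no hub, and `p` is not
  big. Then the search starts at the far end of a path of big vertices through one of the two, whose
  vertices before `x` have no other big neighbours, and follows it to `x` (`SpineRegion.wins`). The
  robber could escape to `p` meanwhile; this is prevented by a probe beyond `p` whenever he
  may have moved there, which does not undo the progress made at the path.

The number of rounds is bounded by induction on the number of vertices where the robber can still be.
-/

/-! ### The game in terms of sets of possible positions -/

namespace LocalizationGame

open SimpleGraph

section Game

variable {V : Type*} {k : ℕ}

/-- The closed neighbourhood of a set of vertices: where the robber may be after his move, if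
before it he was somewhere in `S`. -/
def closedNhd (G : SimpleGraph V) (S : Set V) : Set V :=
  {v | ∃ u ∈ S, v = u ∨ G.Adj u v}

/-- `Wins G k t S`: if `S` is the set of possible positions of the robber just before he moves,
then `k` cops can locate him with at most `t` further probes. -/
def Wins (G : SimpleGraph V) (k : ℕ) : ℕ → Set V → Prop
  | 0, S => S.Subsingleton
  | t + 1, S => S.Subsingleton ∨
      ∃ p : Fin k → V, ∀ d, Wins G k t {v ∈ closedNhd G S | distVector G p v = d}

theorem closedNhd_mono {G : SimpleGraph V} {S S' : Set V} (h : S ⊆ S') :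
    closedNhd G S ⊆ closedNhd G S' := by
  rintro v ⟨u, hu, huv⟩
  exact ⟨u, h hu, huv⟩

theorem subset_closedNhd (G : SimpleGraph V) (S : Set V) : S ⊆ closedNhd G S :=
  fun v hv => ⟨v, hv, Or.inl rfl⟩

theorem Wins.of_subsingleton {G : SimpleGraph V} {t : ℕ} {S : Set V} (h : S.Subsingleton) :
    Wins G k t S := by
  cases t with
  | zero => exact h
  | succ t => exact Or.inl h

theorem Wins.mono {G : SimpleGraph V} {t t' : ℕ} {S S' : Set V} (h : Wins G k t S)
    (ht : t ≤ t') (hS : S' ⊆ S) : Wins G k t' S' := by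
  induction t generalizing t' S S' with
  | zero => exact .of_subsingleton (Set.Subsingleton.anti h hS)
  | succ t ih =>
    obtain ⟨t', rfl⟩ : ∃ m, t' = m + 1 := ⟨t' - 1, by omega⟩
    rcases h with h | ⟨p, hp⟩
    · exact .of_subsingleton (h.anti hS)
    · refine Or.inr ⟨p, fun d => ih (hp d) (by omega) ?_⟩
      rintro v ⟨hv, hd⟩
      exact ⟨closedNhd_mono hS hv, hd⟩

/-- One probe at `q` by a single cop. -/
theorem Wins.probe_one {G : SimpleGraph V} {t s : ℕ} {S : Set V} (q : V) (hst : s + 1 ≤ t)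
    (h : ∀ m : ℕ, Wins G 1 s {v ∈ closedNhd G S | G.dist q v = m}) : Wins G 1 t S := by
  refine Wins.mono (t := s + 1) (Or.inr ⟨fun _ => q, fun d => ?_⟩) hst subset_rfl
  refine (h (d 0)).mono le_rfl ?_
  rintro v ⟨hv, rfl⟩
  exact ⟨hv, rfl⟩

/-- One probe at `q₁`, `q₂` by two cops. -/
theorem Wins.probe_two {G : SimpleGraph V} {t s : ℕ} {S : Set V} (q₁ q₂ : V) (hst : s + 1 ≤ t)
    (h : ∀ m₁ m₂ : ℕ,
      Wins G 2 s {v ∈ closedNhd G S | G.dist q₁ v = m₁ ∧ G.dist q₂ v = m₂}) :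
    Wins G 2 t S := by
  refine Wins.mono (t := s + 1) (Or.inr ⟨![q₁, q₂], fun d => ?_⟩) hst subset_rfl
  refine (h (d 0) (d 1)).mono le_rfl ?_
  rintro v ⟨hv, rfl⟩
  exact ⟨hv, rfl, rfl⟩

/-- The strategy that probes `p` first and continues with `σ d` after the answer `d`. -/
def consStrategy (p : Fin k → V) (σ : (Fin k → ℕ) → CopStrategy V k) : CopStrategy V k
  | [] => p
  | d :: L => σ d L

theorem answers_succ_eq_cons (G : SimpleGraph V) (σ : CopStrategy V k) (r : ℕ → V) (s : ℕ) :
    answers G σ r (s + 1) =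
      distVector G (σ []) (r 0) ::
        answers G (fun L => σ (distVector G (σ []) (r 0) :: L)) (fun i => r (i + 1)) s := by
  induction s with
  | zero => rfl
  | succ s ih =>
    rw [answers, ih, answers]
    rfl

theorem IsRobberPlay.tail {G : SimpleGraph V} {r : ℕ → V} (h : IsRobberPlay G r) :
    IsRobberPlay G (fun i => r (i + 1)) := fun i => h (i + 1)

theorem IsRobberPlay.head_mem {G : SimpleGraph V} {r : ℕ → V} (h : IsRobberPlay G r)
    {S : Set V} (hr : r 0 ∈ S) : r 1 ∈ closedNhd G S := ⟨r 0, hr, h 0⟩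

theorem isRobberPlay_const (G : SimpleGraph V) (v : V) : IsRobberPlay G fun _ => v :=
  fun _ => Or.inl rfl

/-- The play that starts at `v` and continues as `r`. -/
def consPlay (v : V) (r : ℕ → V) : ℕ → V
  | 0 => v
  | i + 1 => r i

theorem answers_consPlay (G : SimpleGraph V) (σ : CopStrategy V k) (v : V) (r : ℕ → V) (s : ℕ) :
    answers G σ (consPlay v r) (s + 1) =
      distVector G (σ []) v :: answers G (fun L => σ (distVector G (σ []) v :: L)) r s :=
  answers_succ_eq_cons G σ (consPlay v r) s

theorem IsRobberPlay.cons {G : SimpleGraph V} {r : ℕ → V} (h : IsRobberPlay G r) {v : V}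
    (hv : r 0 = v ∨ G.Adj v (r 0)) : IsRobberPlay G (consPlay v r) := by
  intro i
  cases i with
  | zero => exact hv
  | succ i => exact h i

/-- `σ` locates, after at least one and at most `t` probes, every robber who before his first move
is known to be in `S`. -/
def LocatesFrom (G : SimpleGraph V) (σ : CopStrategy V k) (t : ℕ) (S : Set V) : Prop :=
  ∀ r, IsRobberPlay G r → r 0 ∈ closedNhd G S → ∃ s, 1 ≤ s ∧ s ≤ t ∧
    ∀ r', IsRobberPlay G r' → r' 0 ∈ closedNhd G S → answers G σ r' s = answers G σ r s →
      r' (s - 1) = r (s - 1)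

theorem Wins.exists_strategy {G : SimpleGraph V} [Nonempty V] {t : ℕ} {S : Set V}
    (h : Wins G k t S) : S.Subsingleton ∨ ∃ σ : CopStrategy V k, LocatesFrom G σ t S := by
  classical
  induction t generalizing S with
  | zero => exact Or.inl h
  | succ t ih =>
    rcases h with h | ⟨p, hp⟩
    · exact Or.inl h
    refine Or.inr ?_
    have key : ∀ d, ∃ σ : CopStrategy V k,
        {v ∈ closedNhd G S | distVector G p v = d}.Subsingleton ∨
          LocatesFrom G σ t {v ∈ closedNhd G S | distVector G p v = d} := by
      intro d
      rcases ih (hp d) with h | ⟨σ, h⟩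
      · exact ⟨fun _ _ => Classical.arbitrary V, Or.inl h⟩
      · exact ⟨σ, Or.inr h⟩
    choose σ hσ using key
    refine ⟨consStrategy p σ, fun r hr hr0 => ?_⟩
    rcases hσ (distVector G p (r 0)) with h | h
    · refine ⟨1, le_rfl, by omega, fun r' hr' hr'0 heq => h ⟨hr'0, ?_⟩ ⟨hr0, rfl⟩⟩
      rw [answers_succ_eq_cons, answers_succ_eq_cons, List.cons.injEq] at heq
      exact heq.1
    · obtain ⟨s, hs1, hst, hs⟩ := h _ hr.tail (hr.head_mem ⟨hr0, rfl⟩)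
      refine ⟨s + 1, by omega, by omega, fun r' hr' hr'0 heq => ?_⟩
      rw [answers_succ_eq_cons, answers_succ_eq_cons, List.cons.injEq] at heq
      have h0 : distVector G p (r' 0) = distVector G p (r 0) := heq.1
      have := hs _ hr'.tail (hr'.head_mem ⟨hr'0, h0⟩) (by
        have h2 := heq.2
        simp only [consStrategy, h0] at h2
        exact h2)
      rw [Nat.sub_add_cancel hs1] at this
      exact this

theorem LocatesFrom.wins {G : SimpleGraph V} {σ : CopStrategy V k} {t : ℕ} {S : Set V}
    (h : LocatesFrom G σ t S) : Wins G k t S := by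
  induction t generalizing S σ with
  | zero =>
    intro u hu
    obtain ⟨s, h1, h2, -⟩ := h _ (isRobberPlay_const G u) (subset_closedNhd G S hu)
    omega
  | succ t ih =>
    refine Or.inr ⟨σ [], fun d => ?_⟩
    by_cases hsub : {v ∈ closedNhd G S | distVector G (σ []) v = d}.Subsingleton
    · exact .of_subsingleton hsub
    refine ih (σ := fun L => σ (d :: L)) fun r hr hr0 => ?_
    obtain ⟨v, ⟨hv, hvd⟩, hvr⟩ := hr0
    obtain ⟨s, h1, h2, h3⟩ := h _ (hr.cons hvr) hv
    obtain ⟨s, rfl⟩ : ∃ m, s = m + 1 := ⟨s - 1, by omega⟩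
    rw [answers_consPlay, hvd] at h3
    rcases Nat.eq_zero_or_pos s with rfl | hs
    · refine absurd ?_ hsub
      have : ∀ w ∈ {v ∈ closedNhd G S | distVector G (σ []) v = d}, w = v := by
        rintro w ⟨hw, hwd⟩
        refine h3 _ (isRobberPlay_const G w) hw ?_
        rw [answers_succ_eq_cons]
        simp only [hwd, answers]
      intro a ha b hb
      rw [this a ha, this b hb]
    · refine ⟨s, hs, by omega, fun r' hr' hr'0 heq => ?_⟩
      obtain ⟨v', ⟨hv', hv'd⟩, hv'r⟩ := hr'0
      have := h3 _ (hr'.cons hv'r) hv' (by rw [answers_consPlay, hv'd, heq])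
      obtain ⟨s, rfl⟩ : ∃ m, s = m + 1 := ⟨s - 1, by omega⟩
      exact this

/-- The cops win within `t` rounds if and only if they win, in the sense of the recursion on the
set of possible positions, starting from no information. -/
theorem copsWinWithin_iff_wins {G : SimpleGraph V} [Nonempty V] {t : ℕ} :
    CopsWinWithin G k t ↔ Wins G k t Set.univ := by
  have hmem : ∀ v, v ∈ closedNhd G Set.univ := fun v => subset_closedNhd G _ (Set.mem_univ v)
  constructor
  · rintro ⟨σ, hσ⟩
    by_cases hsub : (Set.univ : Set V).Subsingleton
    · exact .of_subsingleton hsub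
    refine LocatesFrom.wins (σ := σ) fun r hr _ => ?_
    obtain ⟨s, hst, hs⟩ := hσ r hr
    rcases Nat.eq_zero_or_pos s with rfl | hpos
    · refine absurd ?_ hsub
      intro a _ b _
      rw [show a = r 0 from hs _ (isRobberPlay_const G a) rfl,
        show b = r 0 from hs _ (isRobberPlay_const G b) rfl]
    · exact ⟨s, hpos, hst, fun r' hr' _ => hs r' hr'⟩
  · intro h
    rcases h.exists_strategy with h | ⟨σ, hσ⟩
    · exact ⟨fun _ _ => Classical.arbitrary V, fun r _ =>
        ⟨0, Nat.zero_le _, fun r' _ _ => h (Set.mem_univ _) (Set.mem_univ _)⟩⟩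
    · refine ⟨σ, fun r hr => ?_⟩
      obtain ⟨s, -, hst, hs⟩ := hσ r hr (hmem _)
      exact ⟨s, hst, fun r' hr' => hs r' hr' (hmem _)⟩

end Game

end LocalizationGame

/-! ### Branches of a tree and closed regions -/

namespace LocalizationGame

open SimpleGraph

section Branches

variable {V : Type*} {T : SimpleGraph V}

/-- For adjacent vertices `x`, `y` of a tree, the vertex set of the component of `y` after the
edge `xy` is deleted, described by distances: the vertices that are nearer to `y` than to `x`. -/
def branch (T : SimpleGraph V) (x y : V) : Set V := {v | T.dist x v = T.dist y v + 1}

theorem mem_branch {x y v : V} : v ∈ branch T x y ↔ T.dist x v = T.dist y v + 1 := Iff.rfl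

theorem notMem_branch_iff (hT : T.IsTree) {x y v : V} (h : T.Adj x y) :
    v ∉ branch T x y ↔ v ∈ branch T y x := by
  have := hT.dist_eq_dist_add_one_of_adj v h
  rw [T.dist_comm, T.dist_comm (u := v) (v := y)] at this
  simp only [mem_branch]
  omega

theorem self_notMem_branch (x y : V) : x ∉ branch T x y := by
  simp [mem_branch]

theorem self_mem_branch {x y : V} (h : T.Adj x y) : y ∈ branch T x y := by
  simp [mem_branch, dist_eq_one_iff_adj.mpr h]

theorem dist_pos_of_mem_branch {x y v : V} (h : v ∈ branch T x y) : 1 ≤ T.dist x v := by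
  rw [mem_branch] at h
  omega

theorem eq_of_dist_eq_zero (hT : T.IsTree) {x y : V} (h : T.dist x y = 0) : x = y :=
  hT.connected.dist_eq_zero_iff.mp h

theorem eq_of_mem_branch_of_dist_eq_one (hT : T.IsTree) {x y v : V} (h : v ∈ branch T x y)
    (h1 : T.dist x v = 1) : v = y := by
  rw [mem_branch] at h
  exact (eq_of_dist_eq_zero hT (by omega)).symm

theorem dist_le_dist_add_one (hT : T.IsTree) {v w : V} (h : v = w ∨ T.Adj v w) (x : V) :
    T.dist x w ≤ T.dist x v + 1 ∧ T.dist x v ≤ T.dist x w + 1 := by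
  rcases h with rfl | h
  · omega
  · have := hT.dist_eq_dist_add_one_of_adj x h
    omega

/-- In a tree a vertex has only one neighbour that is nearer to `x`. -/
theorem eq_of_adj_of_dist (hT : T.IsTree) {x v w w' : V} (hw : T.Adj v w) (hw' : T.Adj v w')
    (h : T.dist x v = T.dist x w + 1) (h' : T.dist x v = T.dist x w' + 1) : w = w' := by
  obtain ⟨p, hp⟩ := hT.connected.exists_walk_length_eq_dist x w
  obtain ⟨p', hp'⟩ := hT.connected.exists_walk_length_eq_dist x w'
  have hP : (p.concat hw.symm).IsPath :=
    Walk.isPath_of_length_eq_dist _ (by rw [Walk.length_concat, hp, h])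
  have hP' : (p'.concat hw'.symm).IsPath :=
    Walk.isPath_of_length_eq_dist _ (by rw [Walk.length_concat, hp', h'])
  have heq := (hT.existsUnique_path x v).unique hP hP'
  have := congrArg Walk.penultimate heq
  simpa using this

theorem exists_adj_mem_branch (hT : T.IsTree) {x v : V} (h : x ≠ v) :
    ∃ y, T.Adj x y ∧ v ∈ branch T x y := by
  obtain ⟨p, hp⟩ := hT.connected.exists_walk_length_eq_dist x v
  cases p with
  | nil => exact absurd rfl h
  | cons hxy p =>
    rename_i y
    refine ⟨y, hxy, ?_⟩
    rw [Walk.length_cons] at hp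
    have h1 := T.dist_le p
    have h2 := (dist_le_dist_add_one hT (Or.inr hxy) v)
    rw [T.dist_comm, T.dist_comm (u := v) (v := x)] at h2
    rw [mem_branch]
    omega

theorem eq_of_mem_branch (hT : T.IsTree) {x y y' v : V} (hy : T.Adj x y) (hy' : T.Adj x y')
    (h : v ∈ branch T x y) (h' : v ∈ branch T x y') : y = y' := by
  rw [mem_branch, T.dist_comm, T.dist_comm (v := v)] at h h'
  exact eq_of_adj_of_dist hT hy hy' h h'

/-- The only edge that leaves `branch T x y` is the edge `yx`. -/
theorem eq_of_adj_of_notMem_branch (hT : T.IsTree) {x y v w : V} (hxy : T.Adj x y)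
    (hv : v ∈ branch T x y) (hvw : T.Adj v w) (hw : w ∉ branch T x y) : v = y ∧ w = x := by
  rw [notMem_branch_iff hT hxy] at hw
  rw [mem_branch] at hv hw
  have h1 := hT.dist_eq_dist_add_one_of_adj x hvw
  have h2 := hT.dist_eq_dist_add_one_of_adj y hvw
  have hvy : v = y := by
    by_contra hne
    obtain ⟨u, hu, huy⟩ := exists_adj_mem_branch hT hne
    rw [mem_branch, T.dist_comm, T.dist_comm (v := y)] at huy
    have h3 := dist_le_dist_add_one hT (Or.inr hu) x
    have h4 := dist_le_dist_add_one hT (Or.inr hxy) u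
    rw [T.dist_comm, T.dist_comm (v := x)] at h4
    have := eq_of_adj_of_dist hT (x := x) hu hvw (by omega) (by omega)
    subst this
    omega
  subst hvy
  rw [T.dist_self] at hv h2
  have h0 : T.dist x w = 0 := by omega
  exact ⟨rfl, (eq_of_dist_eq_zero hT h0).symm⟩

/-- A path from inside `branch T x y` to outside goes through the edge `yx`. -/
theorem dist_eq_of_mem_branch (hT : T.IsTree) {x y v w : V} (hxy : T.Adj x y)
    (hv : v ∈ branch T x y) (hw : w ∉ branch T x y) :
    T.dist v w = T.dist x v + T.dist x w := by
  rw [mem_branch] at hv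
  induction hn : T.dist y v generalizing v with
  | zero =>
    obtain rfl := eq_of_dist_eq_zero hT hn
    rw [notMem_branch_iff hT hxy, mem_branch] at hw
    omega
  | succ n ih =>
    have hne : v ≠ y := by
      rintro rfl
      simp at hn
    obtain ⟨u, hu, huy⟩ := exists_adj_mem_branch hT hne
    rw [mem_branch, T.dist_comm, T.dist_comm (v := y)] at huy
    have hux : u ∈ branch T x y := by
      by_contra hux
      exact hne (eq_of_adj_of_notMem_branch hT hxy hv hu hux).1
    have h1 := ih hux (by omega)
    rw [mem_branch] at hux
    -- every vertex outside of the branch is on the side of `u` of the edge `vu`, by induction on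
    -- its distance from `x`
    have key : ∀ m, ∀ w, T.dist x w = m → w ∉ branch T x y → w ∈ branch T v u := by
      intro m
      induction m with
      | zero =>
        intro w hm _
        obtain rfl := eq_of_dist_eq_zero hT hm
        rw [mem_branch, T.dist_comm, T.dist_comm (v := x)]
        omega
      | succ m ihm =>
        intro w hm hw
        have hwx : w ≠ x := by
          rintro rfl
          simp at hm
        obtain ⟨w', hw', hww'⟩ := exists_adj_mem_branch hT hwx
        rw [mem_branch, T.dist_comm, T.dist_comm (v := x)] at hww'
        have hw'b : w' ∉ branch T x y := fun hb =>
          hwx (eq_of_adj_of_notMem_branch hT hxy hb hw'.symm hw).2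
        have h3 := ihm w' (by omega) hw'b
        by_contra hcon
        have h4 := (eq_of_adj_of_notMem_branch hT hu h3 hw'.symm hcon).1
        rw [h4] at hw'b
        exact hw'b hux
    have h5 := key _ w rfl hw
    rw [mem_branch] at h5
    omega

/-- Induction along a branch, away from its root. -/
theorem branch_induction (hT : T.IsTree) {x y : V} (hxy : T.Adj x y) {P : V → Prop} (h0 : P y)
    (hstep : ∀ v w, v ∈ branch T x y → w ∈ branch T x y → T.Adj v w → P v → P w) :
    ∀ v ∈ branch T x y, P v := by
  intro v hv
  induction hn : T.dist y v generalizing v with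
  | zero =>
    obtain rfl := eq_of_dist_eq_zero hT hn
    exact h0
  | succ n ih =>
    have hne : v ≠ y := by
      rintro rfl
      simp at hn
    obtain ⟨u, hu, huy⟩ := exists_adj_mem_branch hT hne
    rw [mem_branch, T.dist_comm, T.dist_comm (v := y)] at huy
    have hux : u ∈ branch T x y := by
      by_contra hux
      exact hne (eq_of_adj_of_notMem_branch hT hxy hv hu hux).1
    exact hstep u v hux hv hu.symm (ih u hux (by omega))

theorem branch_disjoint (hT : T.IsTree) {x y y' : V} (hy : T.Adj x y) (hy' : T.Adj x y')
    (h : y ≠ y') : Disjoint (branch T x y) (branch T x y') :=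
  Set.disjoint_left.mpr fun _ hv hv' => h (eq_of_mem_branch hT hy hy' hv hv')

/-- Beyond a neighbour `z` of `y` other than `x` one stays in `branch T x y`. -/
theorem branch_subset_branch (hT : T.IsTree) {x y z : V} (hxy : T.Adj x y) (hyz : T.Adj y z)
    (hzx : z ≠ x) : branch T y z ⊆ branch T x y := by
  intro v hv
  by_contra h
  rw [notMem_branch_iff hT hxy] at h
  exact hzx (eq_of_mem_branch hT hyz hxy.symm hv h)

/-- The region `A` can be left only at vertices of `X`: every neighbour of a vertex of `A` is in
`A` or in `X`. -/
def ClosedUpTo (T : SimpleGraph V) (A X : Set V) : Prop :=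
  ∀ v ∈ A, ∀ w, T.Adj v w → w ∈ A ∨ w ∈ X

theorem ClosedUpTo.closedNhd_subset {A X S : Set V} (h : ClosedUpTo T A X) (hS : S ⊆ A) :
    closedNhd T S ⊆ A ∪ X := by
  rintro v ⟨u, hu, rfl | huv⟩
  · exact Or.inl (hS hu)
  · exact h u (hS hu) v huv

theorem closedUpTo_branch (hT : T.IsTree) {x y : V} (hxy : T.Adj x y) :
    ClosedUpTo T (branch T x y) {x} := by
  intro v hv w hvw
  by_contra h
  rw [not_or] at h
  exact h.2 (eq_of_adj_of_notMem_branch hT hxy hv hvw h.1).2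

theorem ClosedUpTo.branch_subset (hT : T.IsTree) {A X : Set V} (h : ClosedUpTo T A X) {x y : V}
    (hxy : T.Adj x y) (hy : y ∈ A) (hX : ∀ v ∈ X, v ∉ branch T x y) : branch T x y ⊆ A :=
  branch_induction hT hxy hy fun v w _ hw hvw hvA =>
    (h v hvA w hvw).resolve_right fun hwX => hX w hwX hw

/-- A vertex of a region `A` that cannot be left towards `x` except at `x` is in the branch at `x`
of a neighbour of `x` that belongs to `A`. -/
theorem exists_adj_mem_branch_of_mem (hT : T.IsTree) {A : Set V} {x : V} (hx : x ∉ A)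
    (hA : ∀ v ∈ A, ∀ w, T.Adj v w → T.dist x v = T.dist x w + 1 → w ∈ A ∨ w = x) :
    ∀ v ∈ A, ∃ y ∈ A, T.Adj x y ∧ v ∈ branch T x y := by
  intro v hv
  induction hn : T.dist x v generalizing v with
  | zero =>
    obtain rfl := eq_of_dist_eq_zero hT hn
    exact absurd hv hx
  | succ n ih =>
    have hne : v ≠ x := fun h => hx (h ▸ hv)
    obtain ⟨u, hu, hux⟩ := exists_adj_mem_branch hT hne
    rw [mem_branch, T.dist_comm, T.dist_comm (v := x)] at hux
    rcases hA v hv u hu hux with huA | rfl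
    · obtain ⟨y, hyA, hxy, huy⟩ := ih u huA (by omega)
      refine ⟨y, hyA, hxy, ?_⟩
      by_contra hvy
      exact hne (eq_of_adj_of_notMem_branch hT hxy huy hu.symm hvy).2
    · exact ⟨v, hv, hu.symm, self_mem_branch hu.symm⟩

theorem ClosedUpTo.exists_branch (hT : T.IsTree) {A : Set V} {x : V} (h : ClosedUpTo T A {x})
    (hx : x ∉ A) : ∀ v ∈ A, ∃ y ∈ A, T.Adj x y ∧ v ∈ branch T x y :=
  exists_adj_mem_branch_of_mem hT hx fun v hv w hvw _ => h v hv w hvw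

theorem ClosedUpTo.diff_branch (hT : T.IsTree) {A X : Set V} (h : ClosedUpTo T A X) {x y : V}
    (hxy : T.Adj x y) (hx : x ∉ A) : ClosedUpTo T (A \ branch T x y) X := by
  rintro v ⟨hvA, hvb⟩ w hvw
  rcases h v hvA w hvw with hw | hw
  · by_cases hwb : w ∈ branch T x y
    · rw [(eq_of_adj_of_notMem_branch hT hxy hwb hvw.symm hvb).2] at hvA
      exact absurd hvA hx
    · exact Or.inl ⟨hw, hwb⟩
  · exact Or.inr hw

/-- Below `x`, inside the branch of `y`, a region that could be left only at `x` becomes, without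
`y`, a region that can be left only at `y`. -/
theorem ClosedUpTo.inter_branch_diff (hT : T.IsTree) {A X : Set V} (h : ClosedUpTo T A X)
    {x y : V} (hxy : T.Adj x y) (hX : ∀ v ∈ X, v ∈ branch T x y → v = y) :
    ClosedUpTo T ((A ∩ branch T x y) \ {y}) {y} := by
  rintro v ⟨⟨hvA, hvb⟩, hvy⟩ w hvw
  have hwb : w ∈ branch T x y := by
    by_contra hwb
    exact hvy (eq_of_adj_of_notMem_branch hT hxy hvb hvw hwb).1
  by_cases hwy : w = y
  · exact Or.inr hwy
  · rcases h v hvA w hvw with hw | hw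
    · exact Or.inl ⟨⟨hw, hwb⟩, hwy⟩
    · exact absurd (hX w hw hwb) hwy

end Branches

end LocalizationGame

/-! ### Hubs: lower bound for one cop, upper bound for two cops -/

namespace LocalizationGame

open SimpleGraph

section Hubs

variable {V : Type*} {T : SimpleGraph V}

/-- A vertex with at least three neighbours. -/
def IsBig (T : SimpleGraph V) (v : V) : Prop :=
  ∃ a b c, T.Adj v a ∧ T.Adj v b ∧ T.Adj v c ∧ a ≠ b ∧ a ≠ c ∧ b ≠ c

/-- `r` is a hub with arms `a`, `b`, `c`: these are three distinct neighbours of `r`, and each of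
them has at least three neighbours. In a tree, this is a copy of the tree on ten vertices that
arises from the star with three edges by attaching two new leaves to each of its leaves. -/
structure IsHub (T : SimpleGraph V) (r a b c : V) : Prop where
  adj_a : T.Adj r a
  adj_b : T.Adj r b
  adj_c : T.Adj r c
  ab : a ≠ b
  ac : a ≠ c
  bc : b ≠ c
  big_a : IsBig T a
  big_b : IsBig T b
  big_c : IsBig T c

theorem IsBig.exists_two {y : V} (h : IsBig T y) (x : V) :
    ∃ u w, T.Adj y u ∧ T.Adj y w ∧ u ≠ w ∧ u ≠ x ∧ w ≠ x := by
  obtain ⟨a, b, c, ha, hb, hc, hab, hac, hbc⟩ := h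
  by_cases h1 : a = x
  · subst h1
    exact ⟨b, c, hb, hc, hbc, hab.symm, hac.symm⟩
  · by_cases h2 : b = x
    · subst h2
      exact ⟨a, c, ha, hc, hac, h1, hbc.symm⟩
    · exact ⟨a, b, ha, hb, hab, h1, h2⟩

theorem ncard_add_ncard_le [Finite V] {s t u : Set V} (h : Disjoint s t) (hs : s ⊆ u)
    (ht : t ⊆ u) : s.ncard + t.ncard ≤ u.ncard := by
  rw [← Set.ncard_union_eq h]
  exact Set.ncard_le_ncard (Set.union_subset hs ht)

theorem three_le_ncard [Finite V] {s : Set V} {a b c : V} (ha : a ∈ s) (hb : b ∈ s) (hc : c ∈ s)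
    (hab : a ≠ b) (hac : a ≠ c) (hbc : b ≠ c) : 3 ≤ s.ncard := by
  rw [← Set.ncard_eq_three.mpr ⟨a, b, c, hab, hac, hbc, rfl⟩]
  refine Set.ncard_le_ncard ?_
  rintro v (rfl | rfl | rfl) <;> assumption

theorem IsBig.three_le_ncard_branch [Finite V] (hT : T.IsTree) {x y : V} (hxy : T.Adj x y)
    (h : IsBig T y) : 3 ≤ (branch T x y).ncard := by
  obtain ⟨u, w, hu, hw, huw, hux, hwx⟩ := h.exists_two x
  exact three_le_ncard (self_mem_branch hxy)
    (branch_subset_branch hT hxy hu hux (self_mem_branch hu))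
    (branch_subset_branch hT hxy hw hwx (self_mem_branch hw)) hu.ne hw.ne huw

/-- One cop does not locate the robber if there is a hub `r`: in each round the robber can keep
either two arms of `r`, or `r` and some other vertex, among his possible positions. -/
theorem IsHub.not_wins_one (hT : T.IsTree) {r a b c : V} (h : IsHub T r a b c) (t : ℕ)
    (S : Set V) (hS : (r ∈ S ∧ ∃ g ∈ S, g ≠ r) ∨ ∃ y y', y ∈ ({a, b, c} : Set V) ∧
      y' ∈ ({a, b, c} : Set V) ∧ y ≠ y' ∧ y ∈ S ∧ y' ∈ S) : ¬ Wins T 1 t S := by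
  have hnsub : ¬ S.Subsingleton := by
    intro hs
    rcases hS with ⟨hr, g, hg, hne⟩ | ⟨y, y', -, -, hne, hy, hy'⟩
    · exact hne (hs hg hr)
    · exact hne (hs hy hy')
  induction t generalizing S with
  | zero => exact hnsub
  | succ t ih =>
    rintro (hsub | ⟨p, hp⟩)
    · exact hnsub hsub
    have hadj : ∀ y ∈ ({a, b, c} : Set V), T.Adj r y := by
      rintro y (rfl | rfl | rfl)
      exacts [h.adj_a, h.adj_b, h.adj_c]
    have hbig : ∀ y ∈ ({a, b, c} : Set V), IsBig T y := by
      rintro y (rfl | rfl | rfl)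
      exacts [h.big_a, h.big_b, h.big_c]
    obtain ⟨q, hq⟩ : ∃ q, q = p 0 := ⟨_, rfl⟩
    have hwin : ∀ m : ℕ, Wins T 1 t {v ∈ closedNhd T S | T.dist q v = m} := by
      intro m
      refine (hp fun _ => m).mono le_rfl ?_
      rintro v ⟨hv, hm⟩
      refine ⟨hv, funext fun i => ?_⟩
      rw [Subsingleton.elim i 0, ← hm, hq]
      rfl
    have next : ∀ m : ℕ, ¬ ((r ∈ {v ∈ closedNhd T S | T.dist q v = m} ∧
        ∃ g ∈ {v ∈ closedNhd T S | T.dist q v = m}, g ≠ r) ∨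
        ∃ y y', y ∈ ({a, b, c} : Set V) ∧ y' ∈ ({a, b, c} : Set V) ∧ y ≠ y' ∧
          y ∈ {v ∈ closedNhd T S | T.dist q v = m} ∧
          y' ∈ {v ∈ closedNhd T S | T.dist q v = m}) := by
      intro m hm
      refine ih _ hm ?_ (hwin m)
      intro hs
      rcases hm with ⟨hr, g, hg, hne⟩ | ⟨y, y', -, -, hne, hy, hy'⟩
      · exact hne (hs hg hr)
      · exact hne (hs hy hy')
    have two : ∀ y ∈ ({a, b, c} : Set V), ∀ y' ∈ ({a, b, c} : Set V), y ≠ y' →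
        y ∈ closedNhd T S → y' ∈ closedNhd T S → q ∈ branch T r y ∨ q ∈ branch T r y' := by
      intro y hy y' hy' hne hyS hy'S
      by_contra hcon
      rw [not_or, notMem_branch_iff hT (hadj y hy), notMem_branch_iff hT (hadj y' hy'),
        mem_branch, mem_branch, T.dist_comm, T.dist_comm (u := y')] at hcon
      exact next _ (Or.inr ⟨y, y', hy, hy', hne, ⟨hyS, hcon.1⟩, ⟨hy'S, hcon.2⟩⟩)
    have one : ∀ y ∈ ({a, b, c} : Set V), y ∈ S → q ∉ branch T r y := by
      intro y hy hyS hqy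
      obtain ⟨u, w, hu, hw, huw, hur, hwr⟩ := (hbig y hy).exists_two r
      obtain ⟨g, hg, hgr, hqg⟩ : ∃ g, T.Adj y g ∧ g ≠ r ∧ q ∉ branch T y g := by
        by_cases hqu : q ∈ branch T y u
        · exact ⟨w, hw, hwr, fun hqw => huw (eq_of_mem_branch hT hu hw hqu hqw)⟩
        · exact ⟨u, hu, hur, hqu⟩
      rw [notMem_branch_iff hT hg, mem_branch] at hqg
      rw [mem_branch] at hqy
      refine next (T.dist y q + 1) (Or.inl ⟨⟨⟨y, hyS, Or.inr (hadj y hy).symm⟩, ?_⟩, g,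
        ⟨⟨y, hyS, Or.inr hg⟩, ?_⟩, hgr⟩)
      · rw [T.dist_comm, hqy]
      · rw [T.dist_comm, hqg]
    rcases hS with ⟨hr, -⟩ | ⟨y, y', hy, hy', hne, hyS, hy'S⟩
    · have hmem : ∀ y ∈ ({a, b, c} : Set V), y ∈ closedNhd T S := fun y hy =>
        ⟨r, hr, Or.inr (hadj y hy)⟩
      have ha : a ∈ ({a, b, c} : Set V) := by simp
      have hb : b ∈ ({a, b, c} : Set V) := by simp
      have hc : c ∈ ({a, b, c} : Set V) := by simp
      have hab := two a ha b hb h.ab (hmem a ha) (hmem b hb)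
      have hac := two a ha c hc h.ac (hmem a ha) (hmem c hc)
      have hbc := two b hb c hc h.bc (hmem b hb) (hmem c hc)
      have n1 := fun h1 h2 => h.ab (eq_of_mem_branch hT h.adj_a h.adj_b (v := q) h1 h2)
      have n2 := fun h1 h2 => h.ac (eq_of_mem_branch hT h.adj_a h.adj_c (v := q) h1 h2)
      have n3 := fun h1 h2 => h.bc (eq_of_mem_branch hT h.adj_b h.adj_c (v := q) h1 h2)
      tauto
    · rcases two y hy y' hy' hne (subset_closedNhd T S hyS) (subset_closedNhd T S hy'S) with
        hq | hq
      · exact one y hy hyS hq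
      · exact one y' hy' hy'S hq

/-- Two cops, a region `A` that can be left only at `x`, and a robber in `A` at known distance
from `x`: a probe of two neighbours of `x` in `A` either discards both of their branches or leads
into one of these branches, at known distance from its root. -/
theorem wins_two_of_closedUpTo [Finite V] (hT : T.IsTree) {A : Set V} {x : V} (hx : x ∉ A)
    (hA : ClosedUpTo T A {x}) {d : ℕ} {S : Set V} (hS : S ⊆ A) (hd : ∀ v ∈ S, T.dist x v = d) :
    Wins T 2 (A.ncard / 2) S := by
  induction hn : A.ncard using Nat.strong_induction_on generalizing A x d S with
  | _ n ih =>
  -- entering the branch of `y`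
  have enter : ∀ y ∈ A, T.Adj x y → ∀ (m t : ℕ) (S' : Set V), S' ⊆ A ∩ branch T x y →
      (∀ v ∈ S', T.dist y v = m) → ((A ∩ branch T x y) \ {y}).ncard / 2 ≤ t →
      Wins T 2 t S' := by
    intro y hyA hxy m t S' hS' hm ht
    by_cases hm0 : m = 0
    · refine .of_subsingleton fun v hv w hw => ?_
      subst hm0
      rw [← eq_of_dist_eq_zero hT (hm v hv), ← eq_of_dist_eq_zero hT (hm w hw)]
    · have hlt : ((A ∩ branch T x y) \ {y}).ncard < n := by
        rw [← hn]
        refine Set.ncard_lt_ncard ⟨fun v hv => hv.1.1, fun h => ?_⟩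
        exact (h hyA).2 rfl
      refine (ih _ hlt (x := y) (by simp) (hA.inter_branch_diff hT hxy ?_) ?_ hm rfl).mono ht
        subset_rfl
      · rintro v rfl hv
        exact absurd hv (self_notMem_branch v y)
      · refine fun v hv => ⟨hS' hv, ?_⟩
        rintro rfl
        exact hm0 (by rw [← hm v hv, T.dist_self])
  by_cases hsub : S.Subsingleton
  · exact .of_subsingleton hsub
  have hne : A.Nonempty := by
    by_contra hne
    rw [Set.not_nonempty_iff_eq_empty] at hne
    exact hsub (by rw [Set.subset_eq_empty hS hne]; exact Set.subsingleton_empty)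
  obtain ⟨v₀, hv₀⟩ := hne
  obtain ⟨y₁, hy₁A, hxy₁, -⟩ := hA.exists_branch hT hx v₀ hv₀
  by_cases hY : ∃ y ∈ A, T.Adj x y ∧ y ≠ y₁
  · obtain ⟨y₂, hy₂A, hxy₂, hy⟩ := hY
    have hn2 : 2 ≤ n := by
      rw [← hn, ← Set.ncard_pair hy]
      exact Set.ncard_le_ncard (by rintro v (rfl | rfl) <;> assumption)
    refine Wins.probe_two (s := n / 2 - 1) y₁ y₂ (by omega) fun m₁ m₂ => ?_
    have hdist : ∀ y, T.Adj x y → ∀ v, v ∉ branch T x y → T.dist y v = T.dist x v + 1 :=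
      fun y hxy v hv => (notMem_branch_iff hT hxy).mp hv
    -- the answer tells in which of the three parts of `A` the robber is
    have loc : ∀ v, T.dist y₁ v = m₁ → T.dist y₂ v = m₂ →
        (v ∈ branch T x y₁ ∧ m₂ = m₁ + 2) ∨ (v ∈ branch T x y₂ ∧ m₁ = m₂ + 2) ∨
        (v ∉ branch T x y₁ ∧ v ∉ branch T x y₂ ∧ m₁ = m₂ ∧ T.dist x v + 1 = m₁) := by
      intro v h1 h2
      by_cases hv1 : v ∈ branch T x y₁
      · have hv2 : v ∉ branch T x y₂ := fun hv2 => hy (eq_of_mem_branch hT hxy₂ hxy₁ hv2 hv1)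
        have := hdist _ hxy₂ v hv2
        have := mem_branch.mp hv1
        exact Or.inl ⟨hv1, by omega⟩
      · have := hdist _ hxy₁ v hv1
        by_cases hv2 : v ∈ branch T x y₂
        · have := mem_branch.mp hv2
          exact Or.inr (Or.inl ⟨hv2, by omega⟩)
        · have := hdist _ hxy₂ v hv2
          exact Or.inr (Or.inr ⟨hv1, hv2, by omega, by omega⟩)
    have hNS : closedNhd T S ⊆ A ∪ {x} := hA.closedNhd_subset hS
    have small : ∀ {y y'}, y' ∈ A → y ∈ A → y' ∉ branch T x y →
        T.Adj x y → ((A ∩ branch T x y) \ {y}).ncard / 2 ≤ n / 2 - 1 := by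
      intro y y' hy' hyA hyy hxy
      have h1 : ((A ∩ branch T x y) \ {y}).ncard + ({y, y'} : Set V).ncard ≤ A.ncard := by
        refine ncard_add_ncard_le ?_ (fun v hv => hv.1.1) ?_
        · rw [Set.disjoint_left]
          rintro v hv (rfl | rfl)
          · exact hv.2 rfl
          · exact hyy hv.1.2
        · rintro v (rfl | rfl) <;> assumption
      rw [Set.ncard_pair (by rintro rfl; exact hyy (self_mem_branch hxy))] at h1
      omega
    have n12 : y₂ ∉ branch T x y₁ := fun h =>
      hy (eq_of_mem_branch hT hxy₂ hxy₁ (self_mem_branch hxy₂) h)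
    have n21 : y₁ ∉ branch T x y₂ := fun h =>
      hy (eq_of_mem_branch hT hxy₂ hxy₁ h (self_mem_branch hxy₁))
    rcases lt_trichotomy m₁ m₂ with hm | hm | hm
    · refine enter y₁ hy₁A hxy₁ m₁ _ _ ?_ (fun v hv => hv.2.1) (small hy₂A hy₁A n12 hxy₁)
      rintro v ⟨hv, h1, h2⟩
      have hvb : v ∈ branch T x y₁ := by
        rcases loc v h1 h2 with h | h | h
        · exact h.1
        · omega
        · omega
      refine ⟨(hNS hv).resolve_right ?_, hvb⟩
      rintro rfl
      exact self_notMem_branch _ _ hvb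
    · by_cases hm1 : m₁ = 1
      · refine .of_subsingleton fun v hv w hw => ?_
        have : ∀ v ∈ {v ∈ closedNhd T S | T.dist y₁ v = m₁ ∧ T.dist y₂ v = m₂}, x = v := by
          rintro v ⟨hv, h1, h2⟩
          apply eq_of_dist_eq_zero hT
          have := loc v h1 h2
          omega
        rw [← this v hv, ← this w hw]
      have hlt : ((A \ branch T x y₁) \ branch T x y₂).ncard + ({y₁, y₂} : Set V).ncard ≤ n := by
        rw [← hn]
        refine ncard_add_ncard_le ?_ (fun v hv => hv.1.1) ?_
        · rw [Set.disjoint_left]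
          rintro v hv (rfl | rfl)
          · exact hv.1.2 (self_mem_branch hxy₁)
          · exact hv.2 (self_mem_branch hxy₂)
        · rintro v (rfl | rfl) <;> assumption
      rw [Set.ncard_pair hy.symm] at hlt
      refine (ih _ (by omega) (A := (A \ branch T x y₁) \ branch T x y₂) (x := x) (d := m₁ - 1)
        (fun h => hx h.1.1)
        ((hA.diff_branch hT hxy₁ hx).diff_branch hT hxy₂ fun h => hx h.1) ?_ ?_ rfl).mono
        (by omega) subset_rfl
      · rintro v ⟨hv, h1, h2⟩
        have h3 := loc v h1 h2
        have h4 : v ∉ branch T x y₁ ∧ v ∉ branch T x y₂ ∧ m₁ = m₂ ∧ T.dist x v + 1 = m₁ := by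
          rcases h3 with h | h | h
          · omega
          · omega
          · exact h
        refine ⟨⟨(hNS hv).resolve_right ?_, h4.1⟩, h4.2.1⟩
        rintro rfl
        have := h4.2.2.2
        simp at this
        omega
      · rintro v ⟨hv, h1, h2⟩
        have h3 := loc v h1 h2
        omega
    · refine enter y₂ hy₂A hxy₂ m₂ _ _ ?_ (fun v hv => hv.2.2) (small hy₁A hy₂A n21 hxy₂)
      rintro v ⟨hv, h1, h2⟩
      have hvb : v ∈ branch T x y₂ := by
        rcases loc v h1 h2 with h | h | h
        · omega
        · exact h.1
        · omega
      refine ⟨(hNS hv).resolve_right ?_, hvb⟩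
      rintro rfl
      exact self_notMem_branch _ _ hvb
  · push Not at hY
    have hAb : A ⊆ branch T x y₁ := by
      intro v hv
      obtain ⟨y, hyA, hxy, hvy⟩ := hA.exists_branch hT hx v hv
      rwa [hY y hyA hxy] at hvy
    refine enter y₁ hy₁A hxy₁ (d - 1) _ _ (fun v hv => ⟨hS hv, hAb (hS hv)⟩) ?_ ?_
    · intro v hv
      have := mem_branch.mp (hAb (hS hv))
      rw [hd v hv] at this
      omega
    · refine Nat.div_le_div_right ?_
      rw [← hn]
      exact Set.ncard_le_ncard fun v hv => hv.1.1

/-- The robber is in a branch, at known distance from its root. -/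
theorem wins_two_of_subset_branch [Finite V] (hT : T.IsTree) {x y : V} (hxy : T.Adj x y)
    {B S : Set V} {m t : ℕ} (hB : ClosedUpTo T B {x}) (hS : S ⊆ B ∩ branch T x y)
    (hm : ∀ v ∈ S, T.dist y v = m) (ht : ((B ∩ branch T x y) \ {y}).ncard / 2 ≤ t) :
    Wins T 2 t S := by
  by_cases hm0 : m = 0
  · refine .of_subsingleton fun v hv w hw => ?_
    subst hm0
    rw [← eq_of_dist_eq_zero hT (hm v hv), ← eq_of_dist_eq_zero hT (hm w hw)]
  · refine (wins_two_of_closedUpTo hT (x := y) (by simp) (hB.inter_branch_diff hT hxy ?_) ?_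
      hm).mono ht subset_rfl
    · rintro v rfl hv
      exact absurd hv (self_notMem_branch v y)
    · refine fun v hv => ⟨hS hv, ?_⟩
      rintro rfl
      exact hm0 (by rw [← hm v hv, T.dist_self])

theorem ncard_inter_branch_diff_add_one_le [Finite V] {x y : V} (hxy : T.Adj x y) (B : Set V) :
    ((B ∩ branch T x y) \ {y}).ncard + 1 ≤ (branch T x y).ncard := by
  refine Nat.succ_le_of_lt (Set.ncard_lt_ncard ⟨fun v hv => hv.1.2, fun h => ?_⟩)
  exact (h (self_mem_branch hxy)).2 rfl

theorem ncard_compl_singleton [Finite V] (x : V) : ({x}ᶜ : Set V).ncard + 1 = Nat.card V := by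
  have := Set.ncard_add_ncard_compl ({x} : Set V)
  rw [Set.ncard_singleton] at this
  omega

theorem closedUpTo_compl_singleton (x : V) : ClosedUpTo T {x}ᶜ {x} :=
  fun _ _ w _ => (Classical.em (w = x)).symm

/-- A robber in a region `A` that can be left only at `r`, at known distance from `r`: two cops
save a round over the general bound for such a region, if a neighbour `c` of `r` in `A` has at
least three neighbours. -/
theorem wins_two_third_arm [Finite V] (hT : T.IsTree) {A : Set V} {r c : V} (hr : r ∉ A)
    (hA : ClosedUpTo T A {r}) {n : ℕ} (hn : A.ncard + 7 ≤ n) (hrc : T.Adj r c) (hcA : c ∈ A)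
    (hc : IsBig T c) {S : Set V} {d : ℕ} (hS : S ⊆ A) (hd : ∀ v ∈ S, T.dist r v = d) :
    Wins T 2 (n / 2 - 4) S := by
  have hbA : ∀ y ∈ A, T.Adj r y → branch T r y ⊆ A := fun y hy hry =>
    hA.branch_subset hT hry hy (by rintro v rfl; exact self_notMem_branch _ _)
  have hdist : ∀ x y, T.Adj x y → ∀ v, v ∉ branch T x y → T.dist y v = T.dist x v + 1 :=
    fun x y hxy v hv => (notMem_branch_iff hT hxy).mp hv
  have hc3 := hc.three_le_ncard_branch hT hrc
  by_cases hY : ∃ y ∈ A, T.Adj r y ∧ y ≠ c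
  · obtain ⟨y, hyA, hry, hyc⟩ := hY
    obtain ⟨u, w, hu, hw, huw, hur, hwr⟩ := hc.exists_two r
    have hdisj := branch_disjoint hT hrc hry hyc.symm
    have hsub : branch T c u ⊆ branch T r c := branch_subset_branch hT hrc hu hur
    have huc : c ∉ branch T c u := self_notMem_branch _ _
    have hcy : (branch T r c).ncard + (branch T r y).ncard ≤ A.ncard :=
      ncard_add_ncard_le hdisj (hbA c hcA hrc) (hbA y hyA hry)
    have hy1 : 1 ≤ (branch T r y).ncard :=
      Nat.one_le_iff_ne_zero.mpr (Set.ncard_ne_zero_of_mem (self_mem_branch hry))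
    -- probing beyond `c` makes the branch of `c` at `r` split
    refine Wins.probe_two (s := n / 2 - 5) u y (by omega) fun m₁ m₂ => ?_
    have hNS : closedNhd T S ⊆ A ∪ {r} := hA.closedNhd_subset hS
    have loc : ∀ v, T.dist u v = m₁ → T.dist y v = m₂ →
        (v ∈ branch T c u ∧ m₁ + 3 = m₂) ∨
        (v ∈ branch T r c ∧ v ∉ branch T c u ∧ m₁ + 1 = m₂ ∧ T.dist c v + 1 = m₁) ∨
        (v ∈ branch T r y ∧ m₁ = m₂ + 3) ∨
        (v ∉ branch T r c ∧ v ∉ branch T r y ∧ m₁ = m₂ + 1 ∧ T.dist r v + 1 = m₂) := by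
      intro v h1 h2
      by_cases hvc : v ∈ branch T r c
      · have h3 := hdist _ _ hry v (Set.disjoint_left.mp hdisj hvc)
        have h4 := mem_branch.mp hvc
        by_cases hvu : v ∈ branch T c u
        · have h5 := mem_branch.mp hvu
          exact Or.inl ⟨hvu, by omega⟩
        · have h5 := hdist _ _ hu v hvu
          exact Or.inr (Or.inl ⟨hvc, hvu, by omega, by omega⟩)
      · have h3 := hdist _ _ hrc v hvc
        have h5 := hdist _ _ hu v fun hvu => hvc (hsub hvu)
        by_cases hvy : v ∈ branch T r y
        · have h4 := mem_branch.mp hvy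
          exact Or.inr (Or.inr (Or.inl ⟨hvy, by omega⟩))
        · have h4 := hdist _ _ hry v hvy
          exact Or.inr (Or.inr (Or.inr ⟨hvc, hvy, by omega, by omega⟩))
    have hclosed := closedUpTo_branch hT hrc
    have hmr : ∀ v ∈ closedNhd T S, v ≠ r → v ∈ A := fun v hv hne =>
      (hNS hv).resolve_right hne
    by_cases e1 : m₁ + 3 = m₂
    · refine wins_two_of_subset_branch hT hu (m := m₁) (closedUpTo_compl_singleton c) ?_
        (fun v hv => hv.2.1) ?_
      · rintro v ⟨-, h1, h2⟩
        have hvb : v ∈ branch T c u := by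
          have := loc v h1 h2
          grind
        refine ⟨?_, hvb⟩
        rintro rfl
        exact huc hvb
      · have h1 : (branch T c u).ncard + 1 ≤ (branch T r c).ncard := by
          refine Nat.succ_le_of_lt (Set.ncard_lt_ncard ⟨hsub, fun h => ?_⟩)
          exact huc (h (self_mem_branch hrc))
        have := ncard_inter_branch_diff_add_one_le hu {c}ᶜ
        omega
    by_cases e2 : m₁ + 1 = m₂
    · have hlocc : ∀ v ∈ {v ∈ closedNhd T S | T.dist u v = m₁ ∧ T.dist y v = m₂},
          v ∈ branch T r c ∧ v ∉ branch T c u ∧ T.dist c v = m₁ - 1 := by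
        rintro v ⟨-, h1, h2⟩
        have := loc v h1 h2
        refine ⟨by grind, by grind, by omega⟩
      by_cases hm1 : m₁ = 1
      · refine .of_subsingleton fun v hv w hw => ?_
        have h1 := (hlocc v hv).2.2
        have h2 := (hlocc w hw).2.2
        rw [hm1] at h1 h2
        rw [← eq_of_dist_eq_zero hT h1, ← eq_of_dist_eq_zero hT h2]
      have hcl : ClosedUpTo T ((({r}ᶜ ∩ branch T r c) \ {c}) \ branch T c u) {c} := by
        refine ((closedUpTo_compl_singleton r).inter_branch_diff hT hrc ?_).diff_branch hT hu
          (by simp)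
        rintro v rfl hv
        exact absurd hv (self_notMem_branch v c)
      refine (wins_two_of_closedUpTo hT (x := c) (d := m₁ - 1) (by simp) hcl ?_ ?_).mono ?_
        subset_rfl
      · intro v hv
        have h1 := hlocc v hv
        refine ⟨⟨⟨?_, h1.1⟩, ?_⟩, h1.2.1⟩
        · rintro rfl
          exact self_notMem_branch _ _ h1.1
        · rintro rfl
          have h2 := hv.2.1
          rw [T.dist_comm, dist_eq_one_iff_adj.mpr hu] at h2
          exact hm1 h2.symm
      · exact fun v hv => (hlocc v hv).2.2
      · have h1 := ncard_inter_branch_diff_add_one_le hrc {r}ᶜ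
        have h2 : ((({r}ᶜ ∩ branch T r c) \ {c}) \ branch T c u).ncard + 1 ≤
            (({r}ᶜ ∩ branch T r c) \ {c}).ncard := by
          refine Nat.succ_le_of_lt (Set.ncard_lt_ncard ⟨Set.sdiff_subset, fun h => ?_⟩)
          refine (h ⟨⟨?_, hsub (self_mem_branch hu)⟩, hu.ne'⟩).2 (self_mem_branch hu)
          exact hur
        omega
    by_cases e3 : m₁ = m₂ + 3
    · refine wins_two_of_subset_branch hT hry (m := m₂) (closedUpTo_compl_singleton r) ?_
        (fun v hv => hv.2.2) ?_
      · rintro v ⟨-, h1, h2⟩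
        have hvb : v ∈ branch T r y := by
          have := loc v h1 h2
          grind
        refine ⟨?_, hvb⟩
        rintro rfl
        exact self_notMem_branch _ _ hvb
      · have := ncard_inter_branch_diff_add_one_le hry {r}ᶜ
        omega
    · have hlocr : ∀ v ∈ {v ∈ closedNhd T S | T.dist u v = m₁ ∧ T.dist y v = m₂},
          v ∉ branch T r c ∧ v ∉ branch T r y ∧ T.dist r v = m₂ - 1 ∧ 1 ≤ m₂ := by
        rintro v ⟨-, h1, h2⟩
        have := loc v h1 h2
        refine ⟨by grind, by grind, by omega, by omega⟩
      by_cases hm1 : m₂ = 1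
      · refine .of_subsingleton fun v hv w hw => ?_
        have h1 := (hlocr v hv).2.2.1
        have h2 := (hlocr w hw).2.2.1
        rw [hm1] at h1 h2
        rw [← eq_of_dist_eq_zero hT h1, ← eq_of_dist_eq_zero hT h2]
      refine (wins_two_of_closedUpTo hT (x := r) (d := m₂ - 1)
        (A := (A \ branch T r c) \ branch T r y) (fun h => hr h.1.1)
        ((hA.diff_branch hT hrc hr).diff_branch hT hry fun h => hr h.1) ?_ ?_).mono ?_ subset_rfl
      · intro v hv
        have h1 := hlocr v hv
        refine ⟨⟨hmr v hv.1 ?_, h1.1⟩, h1.2.1⟩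
        rintro rfl
        have := h1.2.2
        simp at this
        omega
      · exact fun v hv => (hlocr v hv).2.2.1
      · have h1 := Set.ncard_sdiff_add_ncard_of_subset (hbA c hcA hrc)
        have h2 : ((A \ branch T r c) \ branch T r y).ncard ≤ (A \ branch T r c).ncard :=
          Set.ncard_le_ncard Set.sdiff_subset
        omega
  · push Not at hY
    have hAb : A ⊆ branch T r c := by
      intro v hv
      obtain ⟨y, hyA, hry, hvy⟩ := hA.exists_branch hT hr v hv
      rwa [hY y hyA hry] at hvy
    refine wins_two_of_subset_branch hT hrc hA (m := d - 1) (fun v hv => ⟨hS hv, hAb (hS hv)⟩)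
      ?_ ?_
    · intro v hv
      have := mem_branch.mp (hAb (hS hv))
      rw [hd v hv] at this
      omega
    · have h1 := ncard_inter_branch_diff_add_one_le hrc A
      have h2 := Set.ncard_le_ncard (hbA c hcA hrc)
      omega

/-- If there is a hub, two cops win within `⌊n / 2⌋ - 3` rounds. -/
theorem IsHub.wins_two [Finite V] (hT : T.IsTree) {r a b c : V} (h : IsHub T r a b c) :
    10 ≤ Nat.card V ∧ Wins T 2 (Nat.card V / 2 - 3) Set.univ := by
  have ha := h.big_a.three_le_ncard_branch hT h.adj_a
  have hb := h.big_b.three_le_ncard_branch hT h.adj_b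
  have hc := h.big_c.three_le_ncard_branch hT h.adj_c
  have hV := ncard_compl_singleton r
  have nr : ∀ y, branch T r y ⊆ {r}ᶜ := by
    rintro y v hv rfl
    exact self_notMem_branch _ _ hv
  have dab := branch_disjoint hT h.adj_a h.adj_b h.ab
  have dac := branch_disjoint hT h.adj_a h.adj_c h.ac
  have dbc := branch_disjoint hT h.adj_b h.adj_c h.bc
  set A : Set V := ({r}ᶜ \ branch T r a) \ branch T r b with hAdef
  have hcA : branch T r c ⊆ A := fun v hv =>
    ⟨⟨nr c hv, Set.disjoint_right.mp dac hv⟩, Set.disjoint_right.mp dbc hv⟩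
  have hAcard : A.ncard + (branch T r a).ncard + (branch T r b).ncard + 1 = Nat.card V := by
    have h1 := Set.ncard_sdiff_add_ncard_of_subset (nr a)
    have h2 : A.ncard + _ = _ := Set.ncard_sdiff_add_ncard_of_subset
      (s := branch T r b) (t := {r}ᶜ \ branch T r a)
      fun v hv => ⟨nr b hv, Set.disjoint_right.mp dab hv⟩
    omega
  have hAclosed : ClosedUpTo T A {r} :=
    ((closedUpTo_compl_singleton r).diff_branch hT h.adj_a (by simp)).diff_branch hT h.adj_b
      (by simp)
  have hrA : r ∉ A := fun hr => hr.1.1 rfl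
  have hcA3 := Set.ncard_le_ncard hcA
  have hcardV : 10 ≤ Nat.card V := by omega
  refine ⟨hcardV, ?_⟩
  have hdist : ∀ x y, T.Adj x y → ∀ v, v ∉ branch T x y → T.dist y v = T.dist x v + 1 :=
    fun x y hxy v hv => (notMem_branch_iff hT hxy).mp hv
  refine Wins.probe_two (s := Nat.card V / 2 - 4) a b (by omega) fun m₁ m₂ => ?_
  have hclosed := closedUpTo_compl_singleton (T := T) r
  rcases lt_trichotomy m₁ m₂ with hm | hm | hm
  · refine wins_two_of_subset_branch hT h.adj_a (m := m₁) hclosed ?_ (fun v hv => hv.2.1) ?_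
    · rintro v ⟨-, h1, h2⟩
      have hvb : v ∈ branch T r a := by
        by_contra hva
        have h3 := hdist _ _ h.adj_a v hva
        by_cases hvb : v ∈ branch T r b
        · have := mem_branch.mp hvb
          omega
        · have := hdist _ _ h.adj_b v hvb
          omega
      exact ⟨nr a hvb, hvb⟩
    · have := ncard_inter_branch_diff_add_one_le h.adj_a {r}ᶜ
      omega
  · by_cases hm1 : m₁ = 1
    · refine .of_subsingleton fun v hv w hw => ?_
      have : ∀ v ∈ {v ∈ closedNhd T Set.univ | T.dist a v = m₁ ∧ T.dist b v = m₂}, r = v := by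
        rintro v ⟨-, h1, h2⟩
        apply eq_of_dist_eq_zero hT
        by_cases hva : v ∈ branch T r a
        · have h3 := hdist _ _ h.adj_b v (Set.disjoint_left.mp dab hva)
          have := mem_branch.mp hva
          omega
        · have := hdist _ _ h.adj_a v hva
          omega
      rw [← this v hv, ← this w hw]
    have hS : ∀ v ∈ {v ∈ closedNhd T Set.univ | T.dist a v = m₁ ∧ T.dist b v = m₂},
        v ∈ A ∧ T.dist r v = m₁ - 1 := by
      rintro v ⟨-, h1, h2⟩
      have hva : v ∉ branch T r a := fun hva => by
        have h3 := hdist _ _ h.adj_b v (Set.disjoint_left.mp dab hva)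
        have := mem_branch.mp hva
        omega
      have h3 := hdist _ _ h.adj_a v hva
      have hvb : v ∉ branch T r b := fun hvb => by
        have := mem_branch.mp hvb
        omega
      refine ⟨⟨⟨?_, hva⟩, hvb⟩, by omega⟩
      rintro rfl
      rw [T.dist_self] at h3
      omega
    generalize {v ∈ closedNhd T Set.univ | T.dist a v = m₁ ∧ T.dist b v = m₂} = S at hS
    exact wins_two_third_arm hT hrA hAclosed (by omega) h.adj_c (hcA (self_mem_branch h.adj_c))
      h.big_c (fun v hv => (hS v hv).1) (fun v hv => (hS v hv).2)
  · refine wins_two_of_subset_branch hT h.adj_b (m := m₂) hclosed ?_ (fun v hv => hv.2.2) ?_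
    · rintro v ⟨-, h1, h2⟩
      have hvb : v ∈ branch T r b := by
        by_contra hvb
        have h3 := hdist _ _ h.adj_b v hvb
        by_cases hva : v ∈ branch T r a
        · have := mem_branch.mp hva
          omega
        · have := hdist _ _ h.adj_a v hva
          omega
      exact ⟨nr b hvb, hvb⟩
    · have := ncard_inter_branch_diff_add_one_le h.adj_b {r}ᶜ
      omega

end Hubs

end LocalizationGame

/-! ### One cop: discarding branches -/

namespace LocalizationGame

open SimpleGraph

section OneCop

variable {V : Type*} {T : SimpleGraph V}

/-- One probe decides whether the robber, whose distance from `x` is known up to one step, is in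
the branch at `x` of a neighbour `y` with at most two neighbours: the probe is at the neighbour of
`y` other than `x`, or at `y` itself if there is none. Outside of the branch it gives the distance
from `x`, and the vertices of the branch at distance at most two from `x` have different answers. -/
theorem exists_probe_of_not_isBig (hT : T.IsTree) {x y : V} (hxy : T.Adj x y)
    (hy : ¬ IsBig T y) : ∃ q c, (∀ w, w ∉ branch T x y → T.dist q w = T.dist x w + c) ∧
      (∀ v w, v ∈ branch T x y → w ∉ branch T x y → T.dist x v ≤ T.dist x w + 2 →
        T.dist q v ≠ T.dist q w) ∧
      (∀ v w, v ∈ branch T x y → w ∈ branch T x y → T.dist x v ≤ 2 → T.dist x w ≤ 2 →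
        T.dist q v = T.dist q w → v = w) := by
  have toward : ∀ v ∈ branch T x y, v ≠ y →
      ∃ u, T.Adj y u ∧ u ≠ x ∧ T.dist y v = T.dist u v + 1 := by
    intro v hv hne
    obtain ⟨u, hu, huv⟩ := exists_adj_mem_branch hT hne.symm
    refine ⟨u, hu, ?_, huv⟩
    rintro rfl
    rw [mem_branch] at hv huv
    omega
  by_cases hu : ∃ u, T.Adj y u ∧ u ≠ x
  · obtain ⟨u, hu, hux⟩ := hu
    have huniq : ∀ w, T.Adj y w → w ≠ x → w = u := by
      intro w hw hwx
      by_contra hne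
      exact hy ⟨w, u, x, hw, hu, hxy.symm, hne, hwx, hux⟩
    have hub : u ∈ branch T x y :=
      branch_subset_branch hT hxy hu hux (self_mem_branch hu)
    have hxu : T.dist x u = 2 := by
      rw [mem_branch.mp hub, dist_eq_one_iff_adj.mpr hu]
    have hout : ∀ w, w ∉ branch T x y → T.dist u w = T.dist x w + 2 := by
      intro w hw
      rw [dist_eq_of_mem_branch hT hxy hub hw, hxu, add_comm]
    have hin : ∀ v ∈ branch T x y, (v = y ∧ T.dist u v = 1 ∧ T.dist x v = 1) ∨
        T.dist x v = T.dist u v + 2 := by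
      intro v hv
      by_cases hvy : v = y
      · subst hvy
        exact Or.inl ⟨rfl, dist_eq_one_iff_adj.mpr hu.symm, dist_eq_one_iff_adj.mpr hxy⟩
      · obtain ⟨w, hw, hwx, hwv⟩ := toward v hv hvy
        rw [huniq w hw hwx] at hwv
        rw [mem_branch] at hv
        exact Or.inr (by omega)
    refine ⟨u, 2, hout, ?_, ?_⟩
    · intro v w hv hw hle
      have h1 := hout w hw
      rcases hin v hv with h2 | h2 <;> omega
    · intro v w hv hw hv2 hw2 heq
      rcases hin v hv with h1 | h1 <;> rcases hin w hw with h2 | h2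
      · rw [h1.1, h2.1]
      · omega
      · omega
      · rw [← eq_of_dist_eq_zero hT (show T.dist u v = 0 by omega),
          ← eq_of_dist_eq_zero hT (show T.dist u w = 0 by omega)]
  · have honly : ∀ v ∈ branch T x y, v = y := by
      intro v hv
      by_contra hne
      obtain ⟨u, h1, h2, -⟩ := toward v hv hne
      exact hu ⟨u, h1, h2⟩
    have hout : ∀ w, w ∉ branch T x y → T.dist y w = T.dist x w + 1 :=
      fun w hw => (notMem_branch_iff hT hxy).mp hw
    refine ⟨y, 1, hout, ?_, ?_⟩
    · intro v w hv hw _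
      rw [honly v hv, hout w hw, T.dist_self]
      omega
    · intro v w hv hw _ _ _
      rw [honly v hv, honly w hw]

/-- In every branch with fewer than `N` vertices below its root, a robber at known distance from
the root is located by one cop within one round less than the number of these vertices. -/
def RootedBound (T : SimpleGraph V) (N : ℕ) : Prop :=
  ∀ p x, T.Adj p x → (branch T p x \ {x}).ncard < N → ∀ d, ∀ S ⊆ branch T p x \ {x},
    (∀ v ∈ S, T.dist x v = d) → Wins T 1 ((branch T p x \ {x}).ncard - 1) S

theorem ncard_branch_diff_add_one [Finite V] {x y : V} (hxy : T.Adj x y) :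
    (branch T x y \ {y}).ncard + 1 = (branch T x y).ncard :=
  Set.ncard_sdiff_singleton_add_one (self_mem_branch hxy)

theorem subsingleton_of_dist_eq (hT : T.IsTree) {S : Set V} {x : V}
    (h : ∀ v ∈ S, T.dist x v = 0) : S.Subsingleton := by
  intro v hv w hw
  rw [← eq_of_dist_eq_zero hT (h v hv), ← eq_of_dist_eq_zero hT (h w hw)]

/-- The robber is in a branch, at known distance from its root. -/
theorem RootedBound.wins_of_dist [Finite V] (hT : T.IsTree) {N : ℕ} (hN : RootedBound T N)
    {x y : V} (hxy : T.Adj x y) (hcard : (branch T x y).ncard ≤ N) {S : Set V} {m t : ℕ}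
    (hS : S ⊆ branch T x y) (hm : ∀ v ∈ S, T.dist y v = m) (ht : (branch T x y).ncard ≤ t + 2) :
    Wins T 1 t S := by
  have h1 := ncard_branch_diff_add_one hxy
  by_cases hm0 : m = 0
  · subst hm0
    exact .of_subsingleton (subsingleton_of_dist_eq hT hm)
  · refine (hN x y hxy (by omega) m S ?_ hm).mono (by omega) subset_rfl
    refine fun v hv => ⟨hS hv, ?_⟩
    rintro rfl
    exact hm0 (by rw [← hm v hv, T.dist_self])

/-- The robber is in a branch, at unknown distance from its root: first the distance is asked
for. -/
theorem RootedBound.wins_of_subset [Finite V] (hT : T.IsTree) {N : ℕ} (hN : RootedBound T N)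
    {x y : V} (hxy : T.Adj x y) (hcard : (branch T x y).ncard ≤ N) {S : Set V} {t : ℕ}
    (hS : S ⊆ branch T x y) (ht : (branch T x y).ncard ≤ t + 1) : Wins T 1 t S := by
  by_cases ht0 : t = 0
  · subst ht0
    exact Set.Subsingleton.anti (Set.ncard_le_one_iff_subsingleton.mp (by omega)) hS
  · refine Wins.probe_one (s := t - 1) x (by omega) fun m => ?_
    have hNS := (closedUpTo_branch hT hxy).closedNhd_subset hS
    by_cases hm : m = 0
    · subst hm
      exact .of_subsingleton (subsingleton_of_dist_eq hT (x := x) fun v hv => hv.2)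
    · have hb : ∀ v ∈ {v ∈ closedNhd T S | T.dist x v = m}, v ∈ branch T x y := by
        rintro v ⟨hv, hvm⟩
        refine (hNS hv).resolve_right ?_
        rintro rfl
        exact hm (by rw [← hvm, T.dist_self])
      refine hN.wins_of_dist hT hxy hcard hb (m := m - 1) ?_ (by omega)
      intro v hv
      have h1 := mem_branch.mp (hb v hv)
      have h2 := hv.2
      omega

theorem eq_of_ncard_branch_lt_two [Finite V] {x y v : V} (hxy : T.Adj x y)
    (h : (branch T x y).ncard < 2) (hv : v ∈ branch T x y) : v = y :=
  Set.ncard_le_one_iff_subsingleton.mp (by omega) hv (self_mem_branch hxy)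

/-- One cop and a region `A` that can be left only at `x`, where at most one neighbour of `x` in
`A` has three or more neighbours: the branches of the other neighbours are discarded one by one,
those with a single vertex first. A round is saved if some branch has more than one vertex. -/
theorem RootedBound.wins_of_closedUpTo [Finite V] (hT : T.IsTree) {N : ℕ} (hN : RootedBound T N)
    {A : Set V} {x : V} (hx : x ∉ A) (hA : ClosedUpTo T A {x}) (hAN : A.ncard ≤ N)
    (hbig : ∀ y ∈ A, ∀ y' ∈ A, T.Adj x y → T.Adj x y' → IsBig T y → IsBig T y' → y = y')
    {d t : ℕ} {S : Set V} (hS : S ⊆ A) (hd : ∀ v ∈ S, T.dist x v = d) (ht : A.ncard ≤ t + 2)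
    (ht' : (¬ ∃ y ∈ A, T.Adj x y ∧ 2 ≤ (branch T x y).ncard) → A.ncard ≤ t + 1) :
    Wins T 1 t S := by
  induction hn : A.ncard using Nat.strong_induction_on generalizing A d t S with
  | _ n ih =>
  by_cases hsub : S.Subsingleton
  · exact .of_subsingleton hsub
  have hne : A.Nonempty := by
    by_contra hne
    rw [Set.not_nonempty_iff_eq_empty] at hne
    exact hsub (by rw [Set.subset_eq_empty hS hne]; exact Set.subsingleton_empty)
  have hbA : ∀ y ∈ A, T.Adj x y → branch T x y ⊆ A := fun y hy hxy =>
    hA.branch_subset hT hxy hy (by rintro v rfl; exact self_notMem_branch _ _)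
  obtain ⟨v₀, hv₀⟩ := hne
  obtain ⟨y₁, hy₁A, hxy₁, -⟩ := hA.exists_branch hT hx v₀ hv₀
  by_cases hY : ∃ y ∈ A, T.Adj x y ∧ y ≠ y₁
  · obtain ⟨y₂, hy₂A, hxy₂, hy⟩ := hY
    obtain ⟨y, hyA, hxy, hys, hyl⟩ : ∃ y ∈ A, T.Adj x y ∧ ¬ IsBig T y ∧
        ((branch T x y).ncard < 2 ∨ ∀ z ∈ A, T.Adj x z → 2 ≤ (branch T x z).ncard) := by
      by_cases hl : ∃ y ∈ A, T.Adj x y ∧ (branch T x y).ncard < 2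
      · obtain ⟨y, hyA, hxy, hl⟩ := hl
        refine ⟨y, hyA, hxy, fun hb => ?_, Or.inl hl⟩
        have := hb.three_le_ncard_branch hT hxy
        omega
      · push Not at hl
        by_cases hb : IsBig T y₁
        · exact ⟨y₂, hy₂A, hxy₂, fun hb' => hy (hbig _ hy₂A _ hy₁A hxy₂ hxy₁ hb' hb), Or.inr hl⟩
        · exact ⟨y₁, hy₁A, hxy₁, hb, Or.inr hl⟩
    obtain ⟨y', hy'A, hxy', hy'⟩ : ∃ y' ∈ A, T.Adj x y' ∧ y' ≠ y := by
      by_cases h : y = y₁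
      · exact ⟨y₂, hy₂A, hxy₂, h ▸ hy⟩
      · exact ⟨y₁, hy₁A, hxy₁, Ne.symm h⟩
    have hcard := Set.ncard_sdiff_add_ncard_of_subset (hbA y hyA hxy)
    have hbpos : ∀ z, T.Adj x z → 1 ≤ (branch T x z).ncard := fun z hxz =>
      Nat.one_le_iff_ne_zero.mpr (Set.ncard_ne_zero_of_mem (self_mem_branch hxz))
    have hrest : ∀ z ∈ A, T.Adj x z → z ≠ y →
        (branch T x z).ncard ≤ (A \ branch T x y).ncard ∧ z ∈ A \ branch T x y := by
      intro z hzA hxz hzy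
      have hdis := branch_disjoint hT hxz hxy hzy
      refine ⟨Set.ncard_le_ncard fun v hv => ⟨hbA z hzA hxz hv, Set.disjoint_left.mp hdis hv⟩,
        hzA, Set.disjoint_left.mp hdis (self_mem_branch hxz)⟩
    have hy'1 := hbpos y' hxy'
    have hy1 := hbpos y hxy
    have hr' := (hrest y' hy'A hxy' hy').1
    -- what remains of `A` satisfies the induction hypothesis with one round less
    have hbound : 1 ≤ t ∧ (branch T x y).ncard ≤ t ∧
        ((¬ ∃ z ∈ A \ branch T x y, T.Adj x z ∧ 2 ≤ (branch T x z).ncard) →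
          (A \ branch T x y).ncard ≤ t) := by
      rcases hyl with hl | hl
      · by_cases hz : ∃ z ∈ A, T.Adj x z ∧ 2 ≤ (branch T x z).ncard
        · obtain ⟨z, hzA, hxz, hz⟩ := hz
          have hzr := hrest z hzA hxz (by rintro rfl; omega)
          refine ⟨by omega, by omega, fun hno => absurd ⟨z, hzr.2, hxz, hz⟩ hno⟩
        · have := ht' hz
          exact ⟨by omega, by omega, fun _ => by omega⟩
      · have h1 := hl y hyA hxy
        have h2 := hl y' hy'A hxy'
        exact ⟨by omega, by omega,
          fun hno => absurd ⟨y', (hrest y' hy'A hxy' hy').2, hxy', h2⟩ hno⟩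
    obtain ⟨hb1, hb2, hb3⟩ := hbound
    obtain ⟨q, c, hq1, hq2, -⟩ := exists_probe_of_not_isBig hT hxy hys
    refine Wins.probe_one (s := t - 1) q (by omega) fun m => ?_
    have hNS : closedNhd T S ⊆ A ∪ {x} := hA.closedNhd_subset hS
    have hNd : ∀ v ∈ closedNhd T S, T.dist x v ≤ d + 1 ∧ d ≤ T.dist x v + 1 := by
      rintro v ⟨u, hu, huv⟩
      rw [← hd u hu]
      exact dist_le_dist_add_one hT (huv.imp_left Eq.symm) x
    by_cases hin : ∃ v ∈ {v ∈ closedNhd T S | T.dist q v = m}, v ∈ branch T x y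
    · obtain ⟨v, ⟨hv, hvm⟩, hvb⟩ := hin
      refine hN.wins_of_subset hT hxy (by omega) ?_ (by omega)
      rintro w ⟨hw, hwm⟩
      by_contra hwb
      have h1 := hNd v hv
      have h2 := hNd w hw
      exact hq2 v w hvb hwb (by omega) (by rw [hvm, hwm])
    · push Not at hin
      have hdist : ∀ v ∈ {v ∈ closedNhd T S | T.dist q v = m}, T.dist x v = m - c := by
        intro v hv
        have h1 := hq1 v (hin v hv)
        have h2 := hv.2
        omega
      by_cases hm : m - c = 0
      · rw [hm] at hdist
        exact .of_subsingleton (subsingleton_of_dist_eq hT hdist)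
      · refine ih _ (by omega) (A := A \ branch T x y) (fun h => hx h.1)
          (hA.diff_branch hT hxy hx) (by omega)
          (fun y hy y' hy' => hbig y hy.1 y' hy'.1) ?_ hdist (by omega)
          (fun h => by have := hb3 h; omega) rfl
        intro v hv
        refine ⟨(hNS hv.1).resolve_right ?_, hin v hv⟩
        rintro rfl
        exact hm (by rw [← hdist v hv, T.dist_self])
  · push Not at hY
    have hAb : A ⊆ branch T x y₁ := by
      intro v hv
      obtain ⟨y, hyA, hxy, hvy⟩ := hA.exists_branch hT hx v hv
      rwa [hY y hyA hxy] at hvy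
    have hcard : (branch T x y₁).ncard ≤ A.ncard := Set.ncard_le_ncard (hbA y₁ hy₁A hxy₁)
    refine hN.wins_of_dist hT hxy₁ (by omega) (fun v hv => hAb (hS hv)) (m := d - 1) ?_
      (by omega)
    intro v hv
    have := mem_branch.mp (hAb (hS hv))
    rw [hd v hv] at this
    omega

end OneCop

end LocalizationGame

/-! ### One cop: searching along a path of big vertices -/

namespace LocalizationGame

open SimpleGraph

section Spine

variable {V : Type*} {T : SimpleGraph V}

/-- The situation in the branch of `x` at `p` when `x` has two big neighbours other than `p`, one
of them being `y`, so that `p` itself is not big. The branch is searched from `z`, a vertex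
that is joined to `x` by a path of big vertices and is not beyond `y`; the region `A`, where the
robber may still be, can be left only through `z` and through the edge `xp`. Off the path to `x`,
the neighbours of `z` in `A` are not big. -/
structure SpineRegion (T : SimpleGraph V) (p x y : V) (A : Set V) (z : V) : Prop where
  adj_px : T.Adj p x
  adj_xy : T.Adj x y
  not_big_p : ¬ IsBig T p
  big_y : IsBig T y
  y_ne : y ≠ p
  subset : A ⊆ branch T p x
  z_mem : z ∈ branch T p x
  z_ne : z ≠ x
  z_notMem : z ∉ A
  x_mem : x ∈ A
  y_mem : y ∈ A
  closed : ClosedUpTo T A {z, p}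
  z_notMem_branch : z ∉ branch T x y
  big : ∀ v, T.dist z v + T.dist v x = T.dist z x → IsBig T v
  not_big : ∀ k ∈ A, T.Adj z k → x ∉ branch T z k → ¬ IsBig T k

namespace SpineRegion

variable {p x y z : V} {A : Set V}

theorem p_notMem (h : SpineRegion T p x y A z) : p ∉ A :=
  fun hp => self_notMem_branch _ _ (h.subset hp)

theorem eq_of_adj_p (hT : T.IsTree) (h : SpineRegion T p x y A z) {v : V} (hv : v ∈ A)
    (hvp : T.Adj v p) : v = x :=
  (eq_of_adj_of_notMem_branch hT h.adj_px (h.subset hv) hvp (self_notMem_branch _ _)).1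

theorem exists_branch (hT : T.IsTree) (h : SpineRegion T p x y A z) :
    ∀ v ∈ A, ∃ k ∈ A, T.Adj z k ∧ v ∈ branch T z k := by
  refine exists_adj_mem_branch_of_mem hT h.z_notMem fun v hv w hvw hd => ?_
  rcases h.closed v hv w hvw with hw | rfl | rfl
  · exact Or.inl hw
  · exact Or.inr rfl
  · have := h.eq_of_adj_p hT hv hvw
    subst this
    have h1 := mem_branch.mp h.z_mem
    rw [T.dist_comm, T.dist_comm (u := v)] at h1
    omega

theorem branch_subset (hT : T.IsTree) (h : SpineRegion T p x y A z) {k : V} (hk : k ∈ A)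
    (hzk : T.Adj z k) (hx : x ∉ branch T z k) : branch T z k ⊆ A := by
  refine h.closed.branch_subset hT hzk hk ?_
  rintro v (rfl | rfl)
  · exact self_notMem_branch _ _
  · exact fun hv => h.z_ne (eq_of_adj_of_notMem_branch hT hzk hv h.adj_px hx).2.symm

theorem branch_y_subset (hT : T.IsTree) (h : SpineRegion T p x y A z) : branch T x y ⊆ A := by
  refine h.closed.branch_subset hT h.adj_xy h.y_mem ?_
  rintro v (rfl | rfl)
  · exact h.z_notMem_branch
  · exact fun hv =>
      h.y_ne (eq_of_mem_branch hT h.adj_xy h.adj_px.symm hv (self_mem_branch h.adj_px.symm))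

theorem disjoint_branch (hT : T.IsTree) (h : SpineRegion T p x y A z) {k : V}
    (hzk : T.Adj z k) (hx : x ∉ branch T z k) : Disjoint (branch T x y) (branch T z k) := by
  rw [Set.disjoint_left]
  intro v hv hv'
  have h1 := dist_eq_of_mem_branch hT h.adj_xy hv h.z_notMem_branch
  have h2 := dist_eq_of_mem_branch hT hzk hv' hx
  have h3 : T.dist x z = 0 := by
    rw [T.dist_comm (u := v), T.dist_comm (u := z) (v := x)] at h2
    rw [T.dist_comm (u := v)] at h1
    omega
  exact h.z_ne (eq_of_dist_eq_zero hT h3).symm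

theorem card_branch [Finite V] (hT : T.IsTree) (h : SpineRegion T p x y A z) {k : V}
    (hk : k ∈ A) (hzk : T.Adj z k) (hx : x ∉ branch T z k) :
    (branch T z k).ncard + 4 ≤ A.ncard := by
  have h1 : (branch T z k).ncard + (insert x (branch T x y)).ncard ≤ A.ncard := by
    refine ncard_add_ncard_le ?_ (h.branch_subset hT hk hzk hx) ?_
    · rw [Set.disjoint_insert_right]
      exact ⟨hx, (h.disjoint_branch hT hzk hx).symm⟩
    · exact Set.insert_subset h.x_mem (h.branch_y_subset hT)
  rw [Set.ncard_insert_of_notMem (self_notMem_branch _ _)] at h1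
  have := h.big_y.three_le_ncard_branch hT h.adj_xy
  omega

theorem diff_branch (hT : T.IsTree) (h : SpineRegion T p x y A z) {k : V}
    (hzk : T.Adj z k) (hx : x ∉ branch T z k) : SpineRegion T p x y (A \ branch T z k) z where
  adj_px := h.adj_px
  adj_xy := h.adj_xy
  not_big_p := h.not_big_p
  big_y := h.big_y
  y_ne := h.y_ne
  subset := fun _ hv => h.subset hv.1
  z_mem := h.z_mem
  z_ne := h.z_ne
  z_notMem := fun hz => h.z_notMem hz.1
  x_mem := ⟨h.x_mem, hx⟩
  y_mem := ⟨h.y_mem, Set.disjoint_left.mp (h.disjoint_branch hT hzk hx)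
    (self_mem_branch h.adj_xy)⟩
  closed := h.closed.diff_branch hT hzk h.z_notMem
  z_notMem_branch := h.z_notMem_branch
  big := h.big
  not_big := fun k hk => h.not_big k hk.1

/-- When only the branch towards `x` is left, the search goes on from the next vertex of the
path. -/
theorem shift (hT : T.IsTree) (hH : ∀ r a b c, ¬ IsHub T r a b c)
    (h : SpineRegion T p x y A z) {z' : V} (hzz' : T.Adj z z') (hx : x ∈ branch T z z')
    (hne : z' ≠ x) (hz' : z' ∈ A) :
    SpineRegion T p x y ((A ∩ branch T z z') \ {z'}) z' where
  adj_px := h.adj_px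
  adj_xy := h.adj_xy
  not_big_p := h.not_big_p
  big_y := h.big_y
  y_ne := h.y_ne
  subset := fun _ hv => h.subset hv.1.1
  z_mem := h.subset hz'
  z_ne := hne
  z_notMem := fun hv => hv.2 rfl
  x_mem := ⟨⟨h.x_mem, hx⟩, hne.symm⟩
  y_mem := by
    refine ⟨⟨h.y_mem, ?_⟩, ?_⟩
    · by_contra hy
      exact hne (eq_of_adj_of_notMem_branch hT hzz' hx h.adj_xy hy).1.symm
    · rintro rfl
      exact h.z_ne (eq_of_adj_of_notMem_branch hT h.adj_xy (self_mem_branch h.adj_xy) hzz'.symm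
        h.z_notMem_branch).2
  closed := by
    rintro v ⟨⟨hvA, hvb⟩, hvz'⟩ w hvw
    have hwb : w ∈ branch T z z' := by
      by_contra hwb
      exact hvz' (eq_of_adj_of_notMem_branch hT hzz' hvb hvw hwb).1
    by_cases hwz : w = z'
    · exact Or.inr (Or.inl hwz)
    · rcases h.closed v hvA w hvw with hw | rfl | rfl
      · exact Or.inl ⟨⟨hw, hwb⟩, hwz⟩
      · exact absurd hwb (self_notMem_branch _ _)
      · exact Or.inr (Or.inr rfl)
  z_notMem_branch := fun hz' =>
    h.z_ne (eq_of_adj_of_notMem_branch hT h.adj_xy hz' hzz'.symm h.z_notMem_branch).2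
  big := by
    intro v hv
    apply h.big
    have h1 := mem_branch.mp hx
    have h2 := (dist_le_dist_add_one hT (Or.inr hzz') v)
    have h3 := hT.connected.dist_triangle (u := z) (v := v) (w := x)
    rw [T.dist_comm (u := v) (v := z), T.dist_comm (u := v) (v := z')] at h2
    omega
  not_big := by
    intro k hk hz'k hxk hbig
    have h1 := mem_branch.mp hx
    have hd1 := dist_eq_one_iff_adj.mpr hzz'
    obtain ⟨w, hw, hxw⟩ := exists_adj_mem_branch hT hne
    have h2 := mem_branch.mp hxw
    have h3 := (dist_le_dist_add_one hT (Or.inr hw) z)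
    have h4 := hT.connected.dist_triangle (u := z) (v := w) (w := x)
    refine hH z' z w k ⟨hzz'.symm, hw, hz'k, ?_, ?_, ?_, h.big z (by simp), h.big w (by omega),
      hbig⟩
    · rintro rfl
      rw [mem_branch] at hxw
      omega
    · rintro rfl
      exact h.z_notMem hk.1.1
    · rintro rfl
      exact hxk hxw

/-- The robber is in `A`, beyond `x`, at known distance from `x`. -/
theorem wins_beyond [Finite V] (hT : T.IsTree) (hH : ∀ r a b c, ¬ IsHub T r a b c)
    {N : ℕ} (hN : RootedBound T N) (h : SpineRegion T p x y A z) (hAN : A.ncard ≤ N) {y₁ : V}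
    (hxy₁ : T.Adj x y₁) (hz : z ∈ branch T x y₁) {S : Set V}
    (hS : S ⊆ (A \ {x}) \ branch T x y₁) {d t : ℕ} (hd : ∀ v ∈ S, T.dist x v = d)
    (ht : A.ncard ≤ t + 3) : Wins T 1 t S := by
  have hclosed : ClosedUpTo T ((A \ {x}) \ branch T x y₁) {x} := by
    rintro v ⟨⟨hvA, hvx⟩, hvb⟩ w hvw
    by_cases hwx : w = x
    · exact Or.inr hwx
    have hwb : w ∉ branch T x y₁ := fun hwb =>
      hvx (eq_of_adj_of_notMem_branch hT hxy₁ hwb hvw.symm hvb).2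
    rcases h.closed v hvA w hvw with hw | rfl | rfl
    · exact Or.inl ⟨⟨hw, hwx⟩, hwb⟩
    · exact absurd hz hwb
    · exact absurd (h.eq_of_adj_p hT hvA hvw) hvx
  have hcard : ((A \ {x}) \ branch T x y₁).ncard + 1 ≤ A.ncard := by
    refine Nat.succ_le_of_lt (Set.ncard_lt_ncard ⟨fun v hv => hv.1.1, fun hsub => ?_⟩)
    exact (hsub h.x_mem).1.2 rfl
  have hy₁ : IsBig T y₁ := by
    apply h.big
    have h1 := mem_branch.mp hz
    rw [T.dist_comm (u := x), T.dist_comm (u := y₁)] at h1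
    rw [T.dist_comm (u := y₁), dist_eq_one_iff_adj.mpr hxy₁, h1]
  have hy : y ∉ branch T x y₁ := fun hy => by
    have := eq_of_mem_branch hT h.adj_xy hxy₁ (self_mem_branch h.adj_xy) hy
    subst this
    exact h.z_notMem_branch hz
  have hbig : ∀ w ∈ (A \ {x}) \ branch T x y₁, T.Adj x w → IsBig T w → w = y := by
    intro w hw hxw hwb
    by_contra hne
    refine hH x y₁ y w ⟨hxy₁, h.adj_xy, hxw, ?_, ?_, Ne.symm hne, hy₁, h.big_y, hwb⟩
    · rintro rfl
      exact hy (self_mem_branch h.adj_xy)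
    · rintro rfl
      exact hw.2 (self_mem_branch hxy₁)
  refine hN.wins_of_closedUpTo hT (x := x) (fun hx => hx.1.2 rfl) hclosed (by omega) ?_ hS hd
    (by omega) ?_
  · intro w hw w' hw' hxw hxw' hb hb'
    rw [hbig w hw hxw hb, hbig w' hw' hxw' hb']
  · intro hno
    have := h.big_y.three_le_ncard_branch hT h.adj_xy
    exact absurd ⟨y, ⟨⟨h.y_mem, h.adj_xy.ne'⟩, hy⟩, h.adj_xy, by omega⟩ hno

/-- The search of a spine region. The branches at `z` off the path to `x` are discarded one by one,
then the search moves on along the path. The robber can only leave the region if he was at `x`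
before his move, and then to `p`. Whenever this is possible, a probe beyond `p` finds out whether
he is at `p`, after which he is away from `x`; the two rounds that are lost are made up by
discarding the branches with more than one vertex first, since those with only one vertex are
emptied anyway when the robber is farther than one step away from `z`. -/
theorem wins [Finite V] (hT : T.IsTree) (hH : ∀ r a b c, ¬ IsHub T r a b c)
    {N : ℕ} (hN : RootedBound T N) (h : SpineRegion T p x y A z) (hAN : A.ncard ≤ N) {S : Set V}
    (hS : S ⊆ A) {e t : ℕ} (he : ∀ v ∈ S, T.dist z v = e) (ht : A.ncard ≤ t + 3)
    (htx : x ∈ S → A.ncard ≤ t + 2) : Wins T 1 t S := by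
  induction hn : A.ncard using Nat.strong_induction_on generalizing A z S e t with
  | _ n ih =>
  obtain ⟨z', hz'A, hzz', hxz'⟩ := h.exists_branch hT x h.x_mem
  have hoff : ∀ k, T.Adj z k → k ≠ z' → x ∉ branch T z k := fun k hk hne hx =>
    hne (eq_of_mem_branch hT hk hzz' hx hxz')
  have hxd := mem_branch.mp hxz'
  have hzz'd := dist_eq_one_iff_adj.mpr hzz'
  have hz_of : z' = x → T.Adj x z ∧ z ∈ branch T x z ∧
      ∀ v, v ∈ branch T z z' → v ∉ branch T x z := by
    rintro rfl
    exact ⟨hzz'.symm, self_mem_branch hzz'.symm,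
      fun v hv => (notMem_branch_iff hT hzz'.symm).mpr hv⟩
  -- the robber is in the branch of the next vertex of the path
  have next : ∀ (A₁ S : Set V) (e t : ℕ), SpineRegion T p x y A₁ z → A₁ ⊆ A → z' ∈ A₁ →
      S ⊆ A₁ ∩ branch T z z' → (∀ v ∈ S, T.dist z v = e) → 2 ≤ e → A₁.ncard ≤ t + 3 →
      Wins T 1 t S := by
    intro A₁ S e t h₁ hA₁ hz'A₁ hS he he2 ht
    have hcardA : A₁.ncard ≤ A.ncard := Set.ncard_le_ncard hA₁
    have hd : ∀ v ∈ S, T.dist z' v = e - 1 := by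
      intro v hv
      have h1 := mem_branch.mp (hS hv).2
      rw [he v hv] at h1
      omega
    have hvz' : ∀ v ∈ S, v ≠ z' := by
      rintro v hv rfl
      have := he v hv
      omega
    by_cases hz'x : z' = x
    · obtain ⟨hxz, hzb, hbr⟩ := hz_of hz'x
      refine h₁.wins_beyond hT hH hN (by omega) hxz hzb ?_ (hz'x ▸ hd) ht
      exact fun v hv => ⟨⟨(hS hv).1, hz'x ▸ hvz' v hv⟩, hbr v (hS hv).2⟩
    · have hcard : ((A₁ ∩ branch T z z') \ {z'}).ncard + 1 ≤ A₁.ncard := by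
        refine Nat.succ_le_of_lt (Set.ncard_lt_ncard ⟨fun v hv => hv.1.1, fun hsub => ?_⟩)
        exact (hsub hz'A₁).2 rfl
      exact ih _ (by omega) (h₁.shift hT hH hzz' hxz' hz'x hz'A₁) (by omega)
        (fun v hv => ⟨hS hv, hvz' v hv⟩) hd (by omega) (fun _ => by omega) rfl
  by_cases hsub : S.Subsingleton
  · exact .of_subsingleton hsub
  by_cases hK : ∀ k ∈ A, T.Adj z k → k ≠ z' → (branch T z k).ncard < 2 ∧ 2 ≤ e
  · have hSb : S ⊆ branch T z z' := by
      intro v hv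
      obtain ⟨k, hkA, hzk, hvk⟩ := h.exists_branch hT v (hS hv)
      by_cases hkz' : k = z'
      · rwa [hkz'] at hvk
      · obtain ⟨hk1, hk2⟩ := hK k hkA hzk hkz'
        have h1 := eq_of_ncard_branch_lt_two hzk hk1 hvk
        have h2 := he v hv
        rw [h1, dist_eq_one_iff_adj.mpr hzk] at h2
        omega
    by_cases he2 : 2 ≤ e
    · exact next A S e t h subset_rfl hz'A (fun v hv => ⟨hS hv, hSb hv⟩) he he2 ht
    · refine .of_subsingleton fun v hv w hw => ?_
      have : ∀ v ∈ S, v = z' := by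
        intro v hv
        have h1 := dist_pos_of_mem_branch (hSb hv)
        have h2 := he v hv
        exact eq_of_mem_branch_of_dist_eq_one hT (hSb hv) (by omega)
      rw [this v hv, this w hw]
  -- a branch `k` to be discarded, with more than one vertex if possible
  obtain ⟨k, hkA, hzk, hkz', hkl⟩ : ∃ k ∈ A, T.Adj z k ∧ k ≠ z' ∧ (2 ≤ (branch T z k).ncard ∨
      (e ≤ 1 ∧ ∀ k ∈ A, T.Adj z k → k ≠ z' → (branch T z k).ncard < 2)) := by
    by_cases hl : ∃ k ∈ A, T.Adj z k ∧ k ≠ z' ∧ 2 ≤ (branch T z k).ncard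
    · obtain ⟨k, hkA, hzk, hkz', hk⟩ := hl
      exact ⟨k, hkA, hzk, hkz', Or.inl hk⟩
    · push Not at hl hK
      obtain ⟨k, hkA, hzk, hkz', hk⟩ := hK
      exact ⟨k, hkA, hzk, hkz', Or.inr ⟨by have := hk (hl k hkA hzk hkz'); omega, hl⟩⟩
  have hxk := hoff k hzk hkz'
  have hkcard := h.card_branch hT hkA hzk hxk
  have hk1 : 1 ≤ (branch T z k).ncard :=
    Nat.one_le_iff_ne_zero.mpr (Set.ncard_ne_zero_of_mem (self_mem_branch hzk))
  have hA₁card := Set.ncard_sdiff_add_ncard_of_subset (h.branch_subset hT hkA hzk hxk)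
  have h₁ := h.diff_branch hT hzk hxk
  have hz'A₁ : z' ∈ A \ branch T z k := ⟨hz'A, fun hz' =>
    hkz' (eq_of_mem_branch hT hzk hzz' hz' (self_mem_branch hzz'))⟩
  have hA₁A : A \ branch T z k ⊆ A := Set.sdiff_subset
  generalize hA₁ : A \ branch T z k = A₁ at h₁ hA₁card hz'A₁ hA₁A
  -- if all these branches have one vertex, a robber not next to `z` is in none of them
  have hfar : (∀ k ∈ A, T.Adj z k → k ≠ z' → (branch T z k).ncard < 2) → ∀ v ∈ A,
      2 ≤ T.dist z v → v ∈ branch T z z' := by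
    intro hl v hv h2
    obtain ⟨k', hk'A, hzk', hvk'⟩ := h.exists_branch hT v hv
    by_cases hk'z' : k' = z'
    · rwa [hk'z'] at hvk'
    · have h1 := eq_of_ncard_branch_lt_two hzk' (hl k' hk'A hzk' hk'z') hvk'
      rw [h1, dist_eq_one_iff_adj.mpr hzk'] at h2
      omega
  obtain ⟨q, c, hq1, hq2, -⟩ := exists_probe_of_not_isBig hT hzk (h.not_big k hkA hzk hxk)
  refine Wins.probe_one (s := t - 1) q (by omega) fun m => ?_
  have hNS : closedNhd T S ⊆ A ∪ {z, p} := h.closed.closedNhd_subset hS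
  have hNd : ∀ v ∈ closedNhd T S, T.dist z v ≤ e + 1 ∧ e ≤ T.dist z v + 1 := by
    rintro v ⟨u, hu, huv⟩
    rw [← he u hu]
    exact dist_le_dist_add_one hT (huv.imp_left Eq.symm) z
  by_cases hin : ∃ v ∈ {v ∈ closedNhd T S | T.dist q v = m}, v ∈ branch T z k
  · obtain ⟨v, ⟨hv, hvm⟩, hvb⟩ := hin
    refine hN.wins_of_subset hT hzk (by omega) ?_ (by omega)
    rintro w ⟨hw, hwm⟩
    by_contra hwb
    have h1 := hNd v hv
    have h2 := hNd w hw
    exact hq2 v w hvb hwb (by omega) (by rw [hvm, hwm])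
  push Not at hin
  have he' : ∀ v ∈ {v ∈ closedNhd T S | T.dist q v = m}, T.dist z v = m - c := by
    intro v hv
    have h1 := hq1 v (hin v hv)
    have h2 := hv.2
    omega
  have hsubN : {v ∈ closedNhd T S | T.dist q v = m} ⊆ closedNhd T S := fun v hv => hv.1
  generalize {v ∈ closedNhd T S | T.dist q v = m} = S₁ at hin he' hsubN
  generalize m - c = e₁ at he'
  by_cases he₁ : e₁ = 0
  · rw [he₁] at he'
    exact .of_subsingleton (subsingleton_of_dist_eq hT he')
  have hS₁ : ∀ v ∈ S₁, v ∈ A₁ ∨ v = p := by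
    intro v hv
    rcases hNS (hsubN hv) with hvA | rfl | rfl
    · exact Or.inl (hA₁ ▸ ⟨hvA, hin v hv⟩)
    · have := he' v hv
      rw [T.dist_self] at this
      exact absurd this.symm he₁
    · exact Or.inr rfl
  by_cases hpS : p ∉ S₁
  · have hS₁A : S₁ ⊆ A₁ := fun v hv =>
      (hS₁ v hv).resolve_right fun hvp => hpS (hvp ▸ hv)
    by_cases hk2 : 2 ≤ (branch T z k).ncard
    · exact ih _ (by omega) h₁ (by omega) hS₁A he' (by omega) (fun _ => by omega) rfl
    obtain ⟨he1, hl⟩ := hkl.resolve_left hk2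
    by_cases he₁2 : 2 ≤ e₁
    · refine next A₁ S₁ e₁ _ h₁ hA₁A hz'A₁ (fun v hv => ⟨hS₁A hv, ?_⟩) he' he₁2 (by omega)
      exact hfar hl v (hA₁A (hS₁A hv)) (by rw [he' v hv]; exact he₁2)
    · refine ih _ (by omega) h₁ (by omega) hS₁A he' (by omega) (fun hxS₁ => ?_) rfl
      -- the robber can be at `x`, next to `z`, only if he was already there
      have hxS : x ∈ S := by
        obtain ⟨u, hu, hux⟩ := hsubN hxS₁
        rcases hux with rfl | hux
        · exact hu
        · have h1 := he' x hxS₁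
          have h2 := he u hu
          have h3 := hT.dist_eq_dist_add_one_of_adj z hux
          have h4 : T.dist z u ≠ 0 := fun h0 =>
            h.z_notMem (eq_of_dist_eq_zero hT h0 ▸ hS hu)
          omega
      have := htx hxS
      omega
  -- the robber may be at `p`
  push Not at hpS
  have hxS : x ∈ S := by
    obtain ⟨u, hu, hup⟩ := hsubN hpS
    rcases hup with rfl | hup
    · exact absurd (hS hu) h.p_notMem
    · exact h.eq_of_adj_p hT (hS hu) hup ▸ hu
  have htx' := htx hxS
  have hzx : T.dist z x = e := he x hxS
  have hzp : T.dist z p = e + 1 := by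
    have h1 := mem_branch.mp h.z_mem
    rw [T.dist_comm (u := p), T.dist_comm (u := x), hzx] at h1
    exact h1
  have he₁e : e₁ = e + 1 := by rw [← he' p hpS, hzp]
  have hpx := h.adj_px
  have hpout : ∀ v, v ∉ branch T x p ↔ v ∈ branch T p x := fun v =>
    notMem_branch_iff hT hpx.symm
  obtain ⟨q₂, c₂, hr1, hr2, hr3⟩ := exists_probe_of_not_isBig hT hpx.symm h.not_big_p
  refine Wins.probe_one (s := t - 2) q₂ (by omega) fun m₂ => ?_
  have hNS₁ : ∀ v ∈ closedNhd T S₁, (v ∈ branch T x p ∧ T.dist x v ≤ 2) ∨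
      (v ∈ A₁ ∧ e ≤ T.dist z v) := by
    rintro v ⟨u, hu, huv⟩
    have hzu := he' u hu
    have hzv := dist_le_dist_add_one hT (huv.imp_left Eq.symm) z
    rcases hS₁ u hu with huA | rfl
    · by_cases hvp : v = p
      · subst hvp
        exact Or.inl ⟨self_mem_branch hpx.symm, by rw [dist_eq_one_iff_adj.mpr hpx.symm]; omega⟩
      refine Or.inr ⟨?_, by omega⟩
      rcases huv with rfl | huv
      · exact huA
      · rcases h₁.closed u huA v huv with hv | rfl | rfl
        · exact hv
        · rw [T.dist_self] at hzv
          omega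
        · exact absurd rfl hvp
    · by_cases hvb : v ∈ branch T x u
      · refine Or.inl ⟨hvb, ?_⟩
        have h1 := dist_le_dist_add_one hT (huv.imp_left Eq.symm) x
        rw [dist_eq_one_iff_adj.mpr hpx.symm] at h1
        omega
      · rcases huv with rfl | huv
        · exact absurd (self_mem_branch hpx.symm) hvb
        · have hvx := (eq_of_adj_of_notMem_branch hT hpx.symm (self_mem_branch hpx.symm) huv
            hvb).2
          exact Or.inr ⟨hvx ▸ h₁.x_mem, by omega⟩
  by_cases hin₂ : ∃ v ∈ {v ∈ closedNhd T S₁ | T.dist q₂ v = m₂}, v ∈ branch T x p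
  · -- at most one vertex beyond the edge `xp` fits the answer
    obtain ⟨v, ⟨hv, hvm⟩, hvb⟩ := hin₂
    have hle : ∀ w ∈ closedNhd T S₁, w ∈ branch T x p → T.dist x w ≤ 2 := by
      intro w hw hwb
      rcases hNS₁ w hw with h1 | h1
      · exact h1.2
      · exact absurd hwb ((hpout w).mpr (h₁.subset h1.1))
    have : ∀ w ∈ {v ∈ closedNhd T S₁ | T.dist q₂ v = m₂}, w = v := by
      rintro w ⟨hw, hwm⟩
      have hwb : w ∈ branch T x p := by
        by_contra hwb
        refine hr2 v w hvb hwb ?_ (by rw [hvm, hwm])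
        have := hle v hv hvb
        omega
      exact hr3 w v hwb hvb (hle w hw hwb) (hle v hv hvb) (by rw [hvm, hwm])
    refine .of_subsingleton fun a ha b hb => ?_
    rw [this a ha, this b hb]
  push Not at hin₂
  have hS₂ : ∀ v ∈ {v ∈ closedNhd T S₁ | T.dist q₂ v = m₂},
      v ∈ A₁ ∧ e ≤ T.dist z v ∧ T.dist x v = m₂ - c₂ := by
    intro v hv
    have h1 := hr1 v (hin₂ v hv)
    have h2 := hv.2
    have h3 := (hNS₁ v hv.1).resolve_left fun h3 => hin₂ v hv h3.1
    exact ⟨h3.1, h3.2, by omega⟩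
  have hsubN₂ : {v ∈ closedNhd T S₁ | T.dist q₂ v = m₂} ⊆ closedNhd T S₁ := fun v hv => hv.1
  generalize {v ∈ closedNhd T S₁ | T.dist q₂ v = m₂} = S₂ at hS₂ hsubN₂
  generalize m₂ - c₂ = d at hS₂
  have hdS₂ : ∀ v ∈ S₂, T.dist x v = d := fun v hv => (hS₂ v hv).2.2
  have he1 : 1 ≤ e := by
    by_contra he0
    exact h.z_ne (eq_of_dist_eq_zero hT (show T.dist z x = 0 by omega))
  by_cases hd0 : d = 0
  · rw [hd0] at hdS₂
    exact .of_subsingleton (subsingleton_of_dist_eq hT hdS₂)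
  have hvx : ∀ v ∈ S₂, v ≠ x := by
    rintro v hv rfl
    have := hdS₂ v hv
    rw [T.dist_self] at this
    omega
  by_cases hd1 : d = 1
  · obtain ⟨y₁, hxy₁, hzy₁⟩ := exists_adj_mem_branch hT h.z_ne.symm
    refine h₁.wins_beyond hT hH hN (by omega) hxy₁ hzy₁ (fun v hv => ⟨⟨(hS₂ v hv).1, hvx v hv⟩,
      fun hvb => ?_⟩) hdS₂ (by omega)
    have h1 := eq_of_mem_branch_of_dist_eq_one hT hvb (by rw [hdS₂ v hv, hd1])
    have h2 := mem_branch.mp hzy₁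
    have h3 := (hS₂ v hv).2.1
    rw [h1, T.dist_comm] at h3
    rw [T.dist_comm, hzx] at h2
    omega
  -- now the robber is at distance at least two from `x`
  have hxN : x ∉ closedNhd T S₂ := by
    rintro ⟨u, hu, hux⟩
    have h1 := dist_le_dist_add_one hT (hux.imp_left Eq.symm) x
    rw [T.dist_self, hdS₂ u hu] at h1
    omega
  have hNS₂ : ∀ v ∈ closedNhd T S₂, v ∈ A₁ ∨ v = z := by
    intro v hv
    obtain ⟨u, hu, huv⟩ := hv
    rcases h₁.closed.closedNhd_subset (fun v hv => (hS₂ v hv).1) ⟨u, hu, huv⟩ with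
      hvA | rfl | rfl
    · exact Or.inl hvA
    · exact Or.inr rfl
    · rcases huv with rfl | huv
      · exact absurd (hS₂ _ hu).1 h₁.p_notMem
      · exact absurd (h₁.eq_of_adj_p hT (hS₂ u hu).1 huv) (hvx u hu)
  by_cases hk2 : 2 ≤ (branch T z k).ncard
  · refine Wins.probe_one (s := t - 3) z (by omega) fun m₃ => ?_
    by_cases hm₃ : m₃ = 0
    · subst hm₃
      exact .of_subsingleton (subsingleton_of_dist_eq hT (x := z) fun v hv => hv.2)
    · refine ih _ (by omega) h₁ (by omega) (fun v hv => ?_) (fun v hv => hv.2) (by omega)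
        (fun hx => absurd hx.1 hxN) rfl
      refine (hNS₂ v hv.1).resolve_right ?_
      rintro rfl
      exact hm₃ (by rw [← hv.2, T.dist_self])
  · obtain ⟨-, hl⟩ := hkl.resolve_left hk2
    have hSb : ∀ v ∈ S₂, v ∈ branch T z z' := by
      intro v hv
      by_contra hvb
      obtain ⟨u, hu, huv⟩ := hsubN₂ hv
      have hub : u ∈ branch T z z' := by
        rcases hS₁ u hu with huA | rfl
        · exact hfar hl u (hA₁A huA) (by rw [he' u hu]; omega)
        · by_contra hub
          have h1 := (eq_of_adj_of_notMem_branch hT hzz' hxz' hpx.symm hub).2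
          rw [h1, T.dist_self] at hzp
          omega
      rcases huv with rfl | huv
      · exact hvb hub
      · have h1 := (eq_of_adj_of_notMem_branch hT hzz' hub huv hvb).2
        have h2 := (hS₂ v hv).2.1
        rw [h1, T.dist_self] at h2
        omega
    by_cases hz'x : z' = x
    · obtain ⟨hxz, hzb, hbr⟩ := hz_of hz'x
      exact h₁.wins_beyond hT hH hN (by omega) hxz hzb
        (fun v hv => ⟨⟨(hS₂ v hv).1, hvx v hv⟩, hbr v (hSb v hv)⟩) hdS₂ (by omega)
    · have he2 : 2 ≤ e := by
        by_contra he2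
        exact hz'x (eq_of_dist_eq_zero hT (show T.dist z' x = 0 by omega))
      have hcard : ((A₁ ∩ branch T z z') \ {z'}).ncard + 1 ≤ A₁.ncard := by
        refine Nat.succ_le_of_lt (Set.ncard_lt_ncard ⟨fun v hv => hv.1.1, fun hsub => ?_⟩)
        exact (hsub hz'A₁).2 rfl
      refine Wins.probe_one (s := t - 3) z' (by omega) fun m₃ => ?_
      by_cases hm₃ : m₃ = 0
      · subst hm₃
        exact .of_subsingleton (subsingleton_of_dist_eq hT (x := z') fun v hv => hv.2)
      · refine ih _ (by omega) (h₁.shift hT hH hzz' hxz' hz'x hz'A₁) (by omega) (fun v hv => ?_)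
          (fun v hv => hv.2) (by omega) (fun hx => absurd hx.1 hxN) rfl
        have hvb : v ∈ branch T z z' := by
          by_contra hvb
          obtain ⟨u, hu, huv⟩ := hv.1
          rcases huv with rfl | huv
          · exact hvb (hSb _ hu)
          · have h1 := (eq_of_adj_of_notMem_branch hT hzz' (hSb u hu) huv hvb).1
            have h2 := (hS₂ u hu).2.1
            rw [h1] at h2
            omega
        refine ⟨⟨(hNS₂ v hv.1).resolve_right ?_, hvb⟩, ?_⟩
        · rintro rfl
          exact self_notMem_branch _ _ hvb
        · rintro rfl
          exact hm₃ (by rw [← hv.2, T.dist_self])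

end SpineRegion

/-- Without hubs, the bound `RootedBound` holds for branches of every size. If at least two
neighbours of the root are big, the search starts at the far end of a longest path of big vertices
that begins with one of them. -/
theorem rootedBound_of_no_hub [Finite V] (hT : T.IsTree) (hH : ∀ r a b c, ¬ IsHub T r a b c)
    (N : ℕ) : RootedBound T N := by
  induction N with
  | zero => exact fun p x _ h => absurd h (Nat.not_lt_zero _)
  | succ N hN =>
    intro p x hpx hcard d S hS hd
    have hclosed : ClosedUpTo T (branch T p x \ {x}) {x} := by
      have := (closedUpTo_branch hT hpx).inter_branch_diff hT hpx (by
        rintro v rfl hv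
        exact absurd hv (self_notMem_branch _ _))
      rwa [Set.inter_self] at this
    by_cases hbig : ∀ y ∈ branch T p x \ {x}, ∀ y' ∈ branch T p x \ {x}, T.Adj x y →
        T.Adj x y' → IsBig T y → IsBig T y' → y = y'
    · by_cases hsub : S.Subsingleton
      · exact .of_subsingleton hsub
      have hpos : (branch T p x \ {x}).ncard ≠ 0 := by
        intro h0
        rw [Set.ncard_eq_zero] at h0
        rw [h0, Set.subset_empty_iff] at hS
        exact hsub (hS ▸ Set.subsingleton_empty)
      exact hN.wins_of_closedUpTo hT (x := x) (fun h => h.2 rfl) hclosed (by omega) hbig hS hd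
        (by omega) (fun _ => by omega)
    push Not at hbig
    obtain ⟨y₁, hy₁, y, hy, hxy₁, hxy, hb₁, hb, hne⟩ := hbig
    have hy₁p : y₁ ≠ p := by
      rintro rfl
      exact self_notMem_branch _ _ hy₁.1
    have hyp : y ≠ p := by
      rintro rfl
      exact self_notMem_branch _ _ hy.1
    have hbx : IsBig T x := ⟨p, y₁, y, hpx.symm, hxy₁, hxy, hy₁p.symm, hyp.symm, hne⟩
    have hbp : ¬ IsBig T p := fun hbp =>
      hH x y₁ y p ⟨hxy₁, hxy, hpx.symm, hne, hy₁p, hyp, hb₁, hb, hbp⟩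
    obtain ⟨z, ⟨hzb, hzbig⟩, hzmax⟩ := Set.exists_max_image
      {z | z ∈ branch T x y₁ ∧ ∀ v, T.dist z v + T.dist v x = T.dist z x → IsBig T v}
      (T.dist x) (Set.toFinite _) ⟨y₁, self_mem_branch hxy₁, by
        intro v hv
        rw [T.dist_comm (u := y₁) (v := x), dist_eq_one_iff_adj.mpr hxy₁] at hv
        rcases Nat.eq_zero_or_pos (T.dist y₁ v) with h0 | h0
        · exact eq_of_dist_eq_zero hT h0 ▸ hb₁
        · exact eq_of_dist_eq_zero hT (show T.dist v x = 0 by omega) ▸ hbx⟩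
    have hzx : z ≠ x := by
      rintro rfl
      exact self_notMem_branch _ _ hzb
    have hzpx : z ∈ branch T p x := branch_subset_branch hT hpx hxy₁ hy₁p hzb
    have hzy : z ∉ branch T x y := fun hzy => hne (eq_of_mem_branch hT hxy₁ hxy hzb hzy)
    have hregion : SpineRegion T p x y (branch T p x \ {z}) z := by
      refine ⟨hpx, hxy, hbp, hb, hyp, Set.sdiff_subset, hzpx, hzx, fun h => h.2 rfl,
        ⟨self_mem_branch hpx, hzx.symm⟩, ⟨hy.1, ?_⟩, ?_, hzy, hzbig, ?_⟩
      · rintro rfl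
        exact hzy (self_mem_branch hxy)
      · rintro v ⟨hv, -⟩ w hvw
        by_cases hwz : w = z
        · exact Or.inr (Or.inl hwz)
        · rcases closedUpTo_branch hT hpx v hv w hvw with hw | hw
          · exact Or.inl ⟨hw, hwz⟩
          · exact Or.inr (Or.inr hw)
      · -- a big neighbour of `z` farther away from `x` would prolong the path
        intro k hk hzk hxk hbk
        have hkd := (notMem_branch_iff hT hzk).mp hxk
        have hkb : k ∈ branch T x y₁ := by
          by_contra hkb
          have h1 := (eq_of_adj_of_notMem_branch hT hxy₁ hzb hzk hkb).2
          exact hxk (h1 ▸ self_mem_branch hzk)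
        have hkmax := hzmax k ⟨hkb, ?_⟩
        · rw [mem_branch] at hkd
          rw [T.dist_comm, T.dist_comm (u := x)] at hkmax
          omega
        · intro v hv
          rw [mem_branch.mp hkd] at hv
          by_cases hvb : v ∈ branch T z k
          · have h1 := dist_eq_of_mem_branch hT hzk hvb hxk
            have h2 := mem_branch.mp hvb
            have h3 : T.dist k v = 0 := by omega
            exact eq_of_dist_eq_zero hT h3 ▸ hbk
          · have h1 := mem_branch.mp ((notMem_branch_iff hT hzk).mp hvb)
            exact hzbig v (by omega)
    have hcardz : (branch T p x \ {z}).ncard + 1 = (branch T p x).ncard :=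
      Set.ncard_sdiff_singleton_add_one hzpx
    have hcardx := ncard_branch_diff_add_one hpx
    have h3 : 3 ≤ (branch T p x).ncard :=
      three_le_ncard hy₁.1 hy.1 (self_mem_branch hpx) hne hxy₁.ne' hxy.ne'
    refine Wins.probe_one (s := (branch T p x \ {x}).ncard - 2) z (by omega) fun m => ?_
    by_cases hm : m = 0
    · subst hm
      exact .of_subsingleton (subsingleton_of_dist_eq hT (x := z) fun v hv => hv.2)
    · refine hregion.wins hT hH hN (by omega) (fun v hv => ⟨?_, ?_⟩) (fun v hv => hv.2)
        (by omega) (fun _ => by omega)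
      · rcases hclosed.closedNhd_subset hS hv.1 with h1 | h1
        · exact h1.1
        · rw [h1]
          exact self_mem_branch hpx
      · rintro rfl
        exact hm (by rw [← hv.2, T.dist_self])

/-- Without hubs, one cop wins on a tree with `n` vertices within `n - 1` rounds: first he probes
a leaf. -/
theorem wins_one_of_no_hub [Finite V] (hT : T.IsTree) (hH : ∀ r a b c, ¬ IsHub T r a b c) :
    Wins T 1 (Nat.card V - 1) Set.univ := by
  classical
  have := Fintype.ofFinite V
  cases subsingleton_or_nontrivial V with
  | inl h => exact .of_subsingleton Set.subsingleton_univ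
  | inr h =>
    obtain ⟨p, hp⟩ := hT.exists_vert_degree_one_of_nontrivial
    have hcard := ncard_compl_singleton p
    obtain ⟨w, hw⟩ := exists_ne p
    have hpos : ({p}ᶜ : Set V).ncard ≠ 0 := Set.ncard_ne_zero_of_mem (a := w) hw
    refine Wins.probe_one (s := Nat.card V - 2) p (by omega) fun m => ?_
    by_cases hm : m = 0
    · subst hm
      exact .of_subsingleton (subsingleton_of_dist_eq hT (x := p) fun v hv => hv.2)
    · refine (rootedBound_of_no_hub hT hH (Nat.card V)).wins_of_closedUpTo hT (A := {p}ᶜ)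
        (x := p) (by simp) (closedUpTo_compl_singleton p) (by omega) ?_ (fun v hv => ?_)
        (fun v hv => hv.2) (by omega) (fun _ => by omega)
      · intro y _ y' _ hy hy' _ _
        obtain ⟨u, -, hu⟩ := (SimpleGraph.degree_eq_one_iff_existsUnique_adj).mp hp
        rw [hu y hy, hu y' hy']
      · rintro rfl
        exact hm (by rw [← hv.2, T.dist_self])

end Spine

end LocalizationGame

theorem corollary2p1 {V : Type*} [Fintype V] (T : SimpleGraph V) (hT : T.IsTree) :
    (LocalizationGame.locNumber T = 1 →
      (LocalizationGame.locCaptureTime T : ℤ) ≤ (Fintype.card V : ℤ) - 1) ∧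
    (LocalizationGame.locNumber T = 2 →
      (LocalizationGame.locCaptureTime T : ℤ) ≤ ⌊(Fintype.card V : ℚ) / 2⌋ - 3) := by
  open LocalizationGame in
  have hne : Nonempty V := hT.connected.nonempty
  have hcard : 0 < Fintype.card V := Fintype.card_pos
  have hfloor : ⌊(Fintype.card V : ℚ) / 2⌋ = ((Fintype.card V / 2 : ℕ) : ℤ) := by
    have := Rat.floor_natCast_div_natCast (Fintype.card V) 2
    exact_mod_cast this
  constructor
  · intro h1
    have hmem : locNumber T ∈ {k | 1 ≤ k ∧ CopsWin T k} := by
      refine Nat.sInf_mem (Nat.nonempty_of_pos_sInf ?_)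
      rw [locNumber] at h1
      omega
    rw [h1] at hmem
    obtain ⟨t, ht⟩ := hmem.2
    -- one cop wins, so there is no hub
    have hH : ∀ r a b c, ¬ IsHub T r a b c := fun r a b c h =>
      h.not_wins_one hT t Set.univ (Or.inl ⟨Set.mem_univ _, a, Set.mem_univ _, h.adj_a.ne'⟩)
        (copsWinWithin_iff_wins.mp ht)
    have hwin := copsWinWithin_iff_wins.mpr (wins_one_of_no_hub hT hH)
    have hle : locCaptureTime T ≤ Nat.card V - 1 := by
      rw [locCaptureTime, h1]
      exact Nat.sInf_le hwin
    rw [Nat.card_eq_fintype_card] at hle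
    omega
  · intro h2
    -- one cop does not win, so there is a hub
    have hnot : ¬ CopsWin T 1 := by
      intro h
      have : locNumber T ≤ 1 := Nat.sInf_le ⟨le_rfl, h⟩
      omega
    have hH : ∃ r a b c, IsHub T r a b c := by
      by_contra hH
      push Not at hH
      exact hnot ⟨_, copsWinWithin_iff_wins.mpr (wins_one_of_no_hub hT hH)⟩
    obtain ⟨r, a, b, c, h⟩ := hH
    obtain ⟨hV, hwin⟩ := h.wins_two hT
    have hle : locCaptureTime T ≤ Nat.card V / 2 - 3 := by
      rw [locCaptureTime, h2]
      exact Nat.sInf_le (copsWinWithin_iff_wins.mpr hwin)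
    rw [Nat.card_eq_fintype_card] at hle hV
    rw [hfloor]
    omega
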